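/- Let $V$ be a real vector space of finite dimension $d$, and let $\mathcal K(V)$ be the set of convex bodies (nonempty compact convex subsets) of $V$, with the topology of the Hausdorff metric. Let $G$ be a group of affine transformations of $V$ that contains all translations. A map $\varphi\colon\mathcal K(V)\to A$ to an abelian group is a valuation if $\varphi(B\cup C)=\varphi(B)+\varphi(C)-\varphi(B\cap C)$ whenever $B,C,B\cup C\in\mathcal K(V)$. Let $\mathcal{CB}=\mathcal{CB}(V,G)$ be the quotient of the free Hausdorff topological abelian group $\mathbb Z\mathcal K(V)$ on the space $\mathcal K(V)$ by the closed subgroup generated by the elements $[B\cup C]-[B]-[C]+[B\cap C]$ ($B,C,B\cup C\in\mathcal K(V)$) and $[X]-[gX]$ ($X\in\mathcal K(V)$, $g\in G$), and let $\Phi\colon\mathcal K(V)\to\mathcal{CB}$, $\Phi(X)=[X]$, be the universal continuous $G$-invariant valuation. Then the following hold. (a) There is a unique continuous map $D\colon[0,\infty)\times\mathcal{CB}\to\mathcal{CB}$ that is a homomorphism in the second variable and satisfies $D(\lambda,[X])=[\lambda X]$ for all $\lambda\in[0,\infty)$ and $X\in\mathcal K(V)$. There are unique maps $\rho_0\colon\mathcal{CB}\to\mathcal{CB}$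 and $\rho_1,\dots,\rho_d\colon[0,\infty)\times\mathcal{CB}\to\mathcal{CB}$, with $\rho_1,\dots,\rho_d$ additive in the first variable, such that $$D(\lambda,x)=\rho_0(x)+\rho_1(\lambda,x)+\rho_2(\lambda^2,x)+\cdots+\rho_d(\lambda^d,x)\qquad(\lambda\in[0,\infty),\ x\in\mathcal{CB}),$$ and these maps are continuous. (b) The maps $e_0=\rho_0$ and $e_i=\rho_i(1,-)$ for $1\le i\le d$ are continuous endomorphisms of the topological group $\mathcal{CB}$ with $e_0+\cdots+e_d=1$, $e_i^2=e_i$, and $e_ie_j=0$ for $i\ne j$. Their images $\mathcal{CB}_i=e_i(\mathcal{CB})$ are closed subgroups, $\mathcal{CB}$ and the $\mathcal{CB}_i$ are Hausdorff, and $x\mapsto(e_i(x))_i$ is an isomorphism of topological groups $$\mathcal{CB}(V,G)\cong\mathcal{CB}_0\oplus\cdots\oplus\mathcal{CB}_d .$$ Correspondingly $\Phi=\Phi_0\oplus\cdots\oplus\Phi_d$, where each $\Phi_i=e_i\circ\Phi\colon\mathcal K(V)\to\mathcal{CB}_i$ is a continuous $G$-invariant valuation. (c) There is an isomorphism of topological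 groups from the discrete group $\mathbb Z$ onto $\mathcal{CB}_0$ that sends $1$ to $\Phi_0(X)$ for every $X\in\mathcal K(V)$, and this element is the class $[\{v\}]$ of any one-point convex body $\{v\}$. (d) For $1\le i\le d$, $\mathcal{CB}_i$ admits the structure of a Hausdorff topological vector space over $\mathbb R$, extending its structure as a topological abelian group, with respect to which $\Phi_i(\lambda X)=\lambda^i\,\Phi_i(X)$ for all $\lambda\in[0,\infty)$ and $X\in\mathcal K(V)$. -/

import Mathlib

open scoped NNReal

noncomputable section

/-! ### Free (Hausdorff) topological abelian groups -/

/-- The free topological abelian group on a topological space `X`: the free abelian group on `X`,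
with the finest group topology for which the inclusion of generators is continuous. -/
def FreeTAG (X : Type*) : Type _ := FreeAbelianGroup X

instance FreeTAG.instAddCommGroup (X : Type*) : AddCommGroup (FreeTAG X) :=
  inferInstanceAs (AddCommGroup (FreeAbelianGroup X))

/-- The inclusion of generators. -/
def FreeTAG.of {X : Type*} (x : X) : FreeTAG X := FreeAbelianGroup.of x

/-- The finest group topology for which `FreeTAG.of` is continuous. In the order on
`AddGroupTopology`, smaller means finer, so this is an infimum (the topology generated by all the
group topologies in question). -/
def FreeTAG.groupTopology (X : Type*) [TopologicalSpace X] : AddGroupTopology (FreeTAG X) :=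
  sInf {t : AddGroupTopology (FreeTAG X) |
    @Continuous X (FreeTAG X) _ t.toTopologicalSpace FreeTAG.of}

instance FreeTAG.instTopologicalSpace (X : Type*) [TopologicalSpace X] :
    TopologicalSpace (FreeTAG X) :=
  (FreeTAG.groupTopology X).toTopologicalSpace

instance FreeTAG.instIsTopologicalAddGroup (X : Type*) [TopologicalSpace X] :
    IsTopologicalAddGroup (FreeTAG X) :=
  (FreeTAG.groupTopology X).toIsTopologicalAddGroup

/-- The free Hausdorff topological abelian group on `X`: the Hausdorff reflection
(the quotient by the closure of `{0}`) of the free topological abelian group. -/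
abbrev FreeHTAG (X : Type*) [TopologicalSpace X] : Type _ :=
  FreeTAG X ⧸ (⊥ : AddSubgroup (FreeTAG X)).topologicalClosure

/-- The class `[x]` of a point `x`. -/
def FreeHTAG.of {X : Type*} [TopologicalSpace X] (x : X) : FreeHTAG X :=
  QuotientAddGroup.mk (FreeTAG.of x)

/-! ### Convex bodies, valuations and the group of convex bodies -/

section ConvexBodies

variable {V : Type*} [NormedAddCommGroup V] [NormedSpace ℝ V] [FiniteDimensional ℝ V]

/-- The image `gK` of a convex body `K` under an affine transformation `g`. -/
def affineImage (g : V ≃ᵃ[ℝ] V) (K : ConvexBody V) : ConvexBody V where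
  carrier := g '' (K : Set V)
  convex' := K.convex.affine_image (g : V →ᵃ[ℝ] V)
  isCompact' := K.isCompact.image (g : V →ᵃ[ℝ] V).continuous_of_finiteDimensional
  nonempty' := K.nonempty.image g

/-- Valuations on convex bodies with values in an abelian group. Here `U` and `I` are the union and
the intersection of `B` and `C`. (When `B ∪ C` is convex, it is connected, so that `B ∩ C` is
automatically nonempty, hence a convex body.) -/
def IsValuation {A : Type*} [AddCommGroup A] (φ : ConvexBody V → A) : Prop :=
  ∀ B C U I : ConvexBody V, (U : Set V) = (B : Set V) ∪ C → (I : Set V) = (B : Set V) ∩ C →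
    φ U = φ B + φ C - φ I

/-- Invariance of a function on convex bodies under a group of affine transformations. -/
def IsAffineInvariant (G : Subgroup (V ≃ᵃ[ℝ] V)) {A : Type*} (φ : ConvexBody V → A) : Prop :=
  ∀ g ∈ G, ∀ K : ConvexBody V, φ (affineImage g K) = φ K

/-- The elements `[B ∪ C] - [B] - [C] + [B ∩ C]` and `[K] - [gK]` of the free Hausdorff
topological abelian group on the space of convex bodies (with the Hausdorff metric). -/
def convexBodyRelations (G : Subgroup (V ≃ᵃ[ℝ] V)) : Set (FreeHTAG (ConvexBody V)) :=
  {z | ∃ B C U I : ConvexBody V, (U : Set V) = (B : Set V) ∪ C ∧ (I : Set V) = (B : Set V) ∩ C ∧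
      z = FreeHTAG.of U - FreeHTAG.of B - FreeHTAG.of C + FreeHTAG.of I} ∪
  {z | ∃ g ∈ G, ∃ K : ConvexBody V, z = FreeHTAG.of K - FreeHTAG.of (affineImage g K)}

variable (V) in
/-- The group of convex bodies: the quotient of the free Hausdorff topological
abelian group on the space of convex bodies by the closed subgroup generated by the relations. -/
abbrev CB (G : Subgroup (V ≃ᵃ[ℝ] V)) : Type _ :=
  FreeHTAG (ConvexBody V) ⧸ (AddSubgroup.closure (convexBodyRelations G)).topologicalClosure

/-- The universal valuation `Φ(X) = [X]`. -/
def universalValuation (G : Subgroup (V ≃ᵃ[ℝ] V)) (X : ConvexBody V) : CB V G :=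
  QuotientAddGroup.mk (FreeHTAG.of X)

/-- A dilation map: a jointly continuous family of endomorphisms `D(r, -)`, `r ∈ [0,∞)`, of the
group of convex bodies with `D(r, [X]) = [rX]`. -/
def IsDilationMap (G : Subgroup (V ≃ᵃ[ℝ] V)) (D : ℝ≥0 → CB V G →+ CB V G) : Prop :=
  Continuous (fun p : ℝ≥0 × CB V G => D p.1 p.2) ∧
  ∀ (r : ℝ≥0) (X : ConvexBody V), D r (universalValuation G X) = universalValuation G (r • X)

end ConvexBodies

/-- A polynomial expansion `f(a) = c₀ + c₁(a¹) + ⋯ + c_d(a^d)` of `f : [0,∞) → M`, where `c₀` is a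
constant (here: a constant function) and `c₁, …, c_d` are homomorphisms `[0,∞) → M`. -/
def IsPolynomialExpansion {M : Type*} [AddCommGroup M] {d : ℕ} (f : ℝ≥0 → M)
    (c : Fin (d + 1) → ℝ≥0 → M) : Prop :=
  (∀ a b : ℝ≥0, c 0 a = c 0 b) ∧
  (∀ i : Fin (d + 1), i ≠ 0 → ∀ a b : ℝ≥0, c i (a + b) = c i a + c i b) ∧
  ∀ a : ℝ≥0, f a = ∑ i : Fin (d + 1), c i (a ^ (i : ℕ))

end

/-! Inclusion–exclusion for a cover of a simplex by translated orthants shows that, for a polytope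
`P` with at most `d + 1` vertices, the mixed differences of order `d + 1` of `r ↦ [rP]` vanish.
They form a continuous valuation in `P`, and an affine dependence of the points spanning a polytope
expresses this valuation through polytopes with fewer vertices; so they vanish for all polytopes,
and by density for all convex bodies. Hence every orbit of the dilation action on `CB` is a Fréchet
polynomial. As continuous biadditive maps are balanced over `[0, ∞)`, its top-order mixed
differences depend only on the product of the increments, so that it expands uniquely in the powers
of `r`. Uniqueness makes the components of an action orthogonal idempotents. On the image of `e_i`,
`ρ_i` is multiplication by scalars if `i ≠ 0`, while `e_0` is the Euler characteristic times the
class of a point. -/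

noncomputable section

section MixedDifferences

variable {S M N : Type*} [AddCommMonoid S] [AddCommGroup M] [AddCommGroup N]

instance leftCommutative_fwdDiff : LeftCommutative (fwdDiff : S → (S → M) → S → M) where
  left_comm a b f := by
    funext x
    simp only [fwdDiff, add_right_comm x a b]
    abel

/-- The mixed difference `Δ_{a₁} ⋯ Δ_{aₙ} f`, for a multiset `s = {a₁, …, aₙ}` of increments. -/
def mixedDiff (s : Multiset S) (f : S → M) : S → M :=
  s.foldr fwdDiff f

@[simp]
theorem mixedDiff_zero (f : S → M) : mixedDiff 0 f = f :=
  Multiset.foldr_zero _ f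

theorem mixedDiff_cons (a : S) (s : Multiset S) (f : S → M) :
    mixedDiff (a ::ₘ s) f = fwdDiff a (mixedDiff s f) :=
  Multiset.foldr_cons _ f a s

theorem mixedDiff_cons_apply (a : S) (s : Multiset S) (f : S → M) (x : S) :
    mixedDiff (a ::ₘ s) f x = mixedDiff s f (x + a) - mixedDiff s f x := by
  rw [mixedDiff_cons, fwdDiff]

theorem mixedDiff_cons' (a : S) (s : Multiset S) (f : S → M) :
    mixedDiff (a ::ₘ s) f = mixedDiff s (fwdDiff a f) := by
  induction s using Multiset.induction_on with
  | empty => rw [mixedDiff_cons, mixedDiff_zero, mixedDiff_zero]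
  | cons b s ih => rw [Multiset.cons_swap, mixedDiff_cons, ih, mixedDiff_cons]

theorem mixedDiff_sub (s : Multiset S) (f g : S → M) :
    mixedDiff s (f - g) = mixedDiff s f - mixedDiff s g := by
  induction s using Multiset.induction_on with
  | empty => simp only [mixedDiff_zero]
  | cons a s ih =>
    funext x
    simp only [Pi.sub_apply, mixedDiff_cons_apply, ih]
    abel

theorem mixedDiff_sum {ι : Type*} (t : Finset ι) (s : Multiset S) (f : ι → S → M) (x : S) :
    mixedDiff s (fun y => ∑ i ∈ t, f i y) x = ∑ i ∈ t, mixedDiff s (f i) x := by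
  induction s using Multiset.induction_on generalizing x with
  | empty => simp only [mixedDiff_zero]
  | cons a s ih => simp only [mixedDiff_cons_apply, ih, Finset.sum_sub_distrib]

theorem mixedDiff_map (g : M →+ N) (s : Multiset S) (f : S → M) (x : S) :
    mixedDiff s (fun y => g (f y)) x = g (mixedDiff s f x) := by
  induction s using Multiset.induction_on generalizing x with
  | empty => simp only [mixedDiff_zero]
  | cons a s ih => simp only [mixedDiff_cons_apply, ih, map_sub]

theorem mixedDiff_const {s : Multiset S} (hs : s ≠ 0) (m : M) :
    mixedDiff s (fun _ : S => m) = 0 := by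
  obtain ⟨a, ha⟩ := Multiset.exists_mem_of_ne_zero hs
  obtain ⟨t, rfl⟩ := Multiset.exists_cons_of_mem ha
  funext x
  rw [mixedDiff_cons', fwdDiff_const]
  exact mixedDiff_map (0 : M →+ M) t (fun _ => m) x

theorem mixedDiff_zero_cons (s : Multiset S) (f : S → M) : mixedDiff (0 ::ₘ s) f = 0 := by
  funext x
  rw [mixedDiff_cons_apply, add_zero, sub_self, Pi.zero_apply]

theorem mixedDiff_add_cons (a b : S) (s : Multiset S) (f : S → M) (x : S) :
    mixedDiff ((a + b) ::ₘ s) f x =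
      mixedDiff (a ::ₘ s) f x + mixedDiff (b ::ₘ s) f x + mixedDiff (a ::ₘ b ::ₘ s) f x := by
  simp only [mixedDiff_cons_apply, add_assoc]
  abel

theorem mixedDiff_map_val {ι : Type*} [DecidableEq ι] (t : Finset ι) (a : ι → S) (f : S → M)
    (x : S) :
    mixedDiff (t.val.map a) f x =
      ∑ u ∈ t.powerset, (-1 : ℤ) ^ u.card • f (x + ∑ i ∈ t \ u, a i) := by
  induction t using Finset.induction_on generalizing x with
  | empty => simp
  | insert j t hj ih =>
    have h_notMem {u : Finset ι} (hu : u ∈ t.powerset) : j ∉ u :=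
      fun h => hj (Finset.mem_powerset.1 hu h)
    rw [Finset.insert_val_of_notMem hj, Multiset.map_cons, mixedDiff_cons_apply, ih, ih,
      Finset.sum_powerset_insert hj, sub_eq_add_neg, ← Finset.sum_neg_distrib]
    congr 1 <;> refine Finset.sum_congr rfl fun u hu => ?_
    · rw [Finset.insert_sdiff_of_notMem t (h_notMem hu),
        Finset.sum_insert fun h => hj (Finset.mem_sdiff.1 h).1, add_assoc]
    · rw [Finset.insert_sdiff_insert, Finset.sdiff_insert_of_notMem hj,
        Finset.card_insert_of_notMem (h_notMem hu), pow_succ, mul_neg_one, neg_smul]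

section Continuity

variable {Y : Type*} [TopologicalSpace Y] [TopologicalSpace S] [ContinuousAdd S]
  [TopologicalSpace M] [ContinuousSub M] {f : S → Y → M}

theorem continuous_mixedDiff (hf : Continuous fun p : S × Y => f p.1 p.2) (s : Multiset S) :
    Continuous fun p : S × Y => mixedDiff s (fun a => f a p.2) p.1 := by
  induction s using Multiset.induction_on with
  | empty => simpa only [mixedDiff_zero] using hf
  | cons a s ih =>
    simp only [mixedDiff_cons_apply]
    exact (ih.comp ((continuous_fst.add continuous_const).prodMk continuous_snd)).sub ih

theorem continuous_mixedDiff_cons_zero (hf : Continuous fun p : S × Y => f p.1 p.2)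
    (s : Multiset S) :
    Continuous fun p : S × Y => mixedDiff (p.1 ::ₘ s) (fun a => f a p.2) 0 := by
  simp only [mixedDiff_cons_apply]
  have h_diff := continuous_mixedDiff hf s
  exact (h_diff.comp ((continuous_const.add continuous_fst).prodMk continuous_snd)).sub
    (h_diff.comp (continuous_const.prodMk continuous_snd))

end Continuity

end MixedDifferences

section Powers

variable {S M : Type*} [CommSemiring S] [AddCommGroup M]

open scoped Nat in
theorem mixedDiff_pow (c : S →+ M) {s : Multiset S} {k : ℕ} (hk : k ≤ s.card) (x : S) :
    mixedDiff s (fun y => c (y ^ k)) x = if k = s.card then c (k ! * s.prod) else 0 := by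
  induction s using Multiset.induction_on generalizing k c with
  | empty => simp [Nat.le_zero.1 hk]
  | cons a s ih =>
    have h_binomial : fwdDiff a (fun y => c (y ^ k)) = fun y =>
        ∑ j ∈ Finset.range k,
          (c.comp (AddMonoidHom.mulRight (a ^ (k - j) * k.choose j))) (y ^ j) := by
      funext y
      simp [fwdDiff, add_pow, Finset.sum_range_succ, mul_assoc]
    rw [Multiset.card_cons] at hk ⊢
    have h_card (j : ℕ) (hj : j ∈ Finset.range k) : j ≤ s.card := by
      have := Finset.mem_range.1 hj
      omega
    rw [mixedDiff_cons', h_binomial, mixedDiff_sum,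
      Finset.sum_congr rfl fun j hj => ih _ (h_card j hj), Finset.sum_ite_eq']
    rcases hk.eq_or_lt with rfl | hk
    · rw [if_pos (Finset.self_mem_range_succ _), if_pos rfl, AddMonoidHom.comp_apply,
        AddMonoidHom.coe_mulRight, Nat.add_sub_cancel_left, pow_one, Nat.choose_succ_self_right,
        Nat.factorial_succ, Multiset.prod_cons, Nat.cast_mul]
      ring_nf
    · rw [if_neg (by rw [Finset.mem_range]; omega), if_neg hk.ne]

end Powers

section FrechetPolynomials

open scoped Nat

/-- A function is a Fréchet polynomial of degree at most `n` if all its mixed differences of order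
`n + 1` vanish. It suffices to require this at `0`: see `IsFrechetPolynomial.succ`. -/
def IsFrechetPolynomial {S M : Type*} [AddCommMonoid S] [AddCommGroup M] (n : ℕ) (f : S → M) :
    Prop :=
  ∀ s : Multiset S, s.card = n + 1 → mixedDiff s f 0 = 0

namespace IsFrechetPolynomial

variable {S M : Type*} [AddCommMonoid S] [AddCommGroup M] {n m : ℕ} {f : S → M}

theorem succ (h : IsFrechetPolynomial n f) : IsFrechetPolynomial (n + 1) f := by
  intro s hs
  obtain ⟨a, t, rfl, ht⟩ := Multiset.card_eq_succ_iff.1 hs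
  obtain ⟨b, u, rfl, hu⟩ := Multiset.card_eq_succ_iff.1 ht
  have h_cons (c : S) : mixedDiff (c ::ₘ u) f 0 = 0 := h _ (by rw [Multiset.card_cons, hu])
  simpa only [h_cons, zero_add, eq_comm] using mixedDiff_add_cons a b u f 0

theorem mono (h : IsFrechetPolynomial m f) (hmn : m ≤ n) : IsFrechetPolynomial n f :=
  Nat.le_induction h (fun _ _ => succ) n hmn

theorem mixedDiff_add_cons (h : IsFrechetPolynomial (n + 1) f) {s : Multiset S} (hs : s.card = n)
    (a b : S) :
    mixedDiff ((a + b) ::ₘ s) f 0 = mixedDiff (a ::ₘ s) f 0 + mixedDiff (b ::ₘ s) f 0 := by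
  rw [_root_.mixedDiff_add_cons,
    h (a ::ₘ b ::ₘ s) (by rw [Multiset.card_cons, Multiset.card_cons, hs]), add_zero]

/-- The top-order mixed differences as a biadditive function of two of the increments. -/
def topDiff (h : IsFrechetPolynomial (n + 2) f) (s : Multiset S) (hs : s.card = n) :
    S →+ S →+ M where
  toFun a :=
    { toFun b := mixedDiff (a ::ₘ b ::ₘ s) f 0
      map_zero' := by rw [Multiset.cons_swap, mixedDiff_zero_cons, Pi.zero_apply]
      map_add' b c := by
        simp only [Multiset.cons_swap a]
        exact h.mixedDiff_add_cons (by rw [Multiset.card_cons, hs]) b c }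
  map_zero' := by
    ext b
    exact congrFun (mixedDiff_zero_cons _ f) 0
  map_add' a b := by
    ext c
    exact h.mixedDiff_add_cons (by rw [Multiset.card_cons, hs]) a b

end IsFrechetPolynomial

section Balanced

variable {E F M : Type*} [AddCommMonoid E] [Module ℝ≥0 E] [AddCommMonoid F] [Module ℝ≥0 F]
  [AddCommGroup M]

theorem map_natCast_div_smul_balanced (B : E →+ F →+ M) (m : ℕ) {n : ℕ} (hn : n ≠ 0) (x : E)
    (y : F) : B ((m / n : ℝ≥0) • x) y = B x ((m / n : ℝ≥0) • y) := by
  have hn' : (n : ℝ≥0) ≠ 0 := Nat.cast_ne_zero.2 hn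
  set x' := (n : ℝ≥0)⁻¹ • x with hx'
  set y' := (n : ℝ≥0)⁻¹ • y with hy'
  have hx : x = n • x' := by rw [hx', ← Nat.cast_smul_eq_nsmul ℝ≥0, smul_inv_smul₀ hn']
  have hy : y = n • y' := by rw [hy', ← Nat.cast_smul_eq_nsmul ℝ≥0, smul_inv_smul₀ hn']
  rw [div_eq_mul_inv, mul_smul, mul_smul, ← hx', ← hy', Nat.cast_smul_eq_nsmul,
    Nat.cast_smul_eq_nsmul, hx, hy]
  simp only [map_nsmul, AddMonoidHom.nsmul_apply]
  exact nsmul_left_comm _ m n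

theorem tendsto_natFloor_mul_div_atTop (r : ℝ≥0) :
    Filter.Tendsto (fun n : ℕ => (⌊(r : ℝ) * n⌋₊ / n : ℝ≥0)) Filter.atTop (nhds r) := by
  have h_real := (tendsto_nat_floor_mul_div_atTop r.coe_nonneg).comp tendsto_natCast_atTop_atTop
  rw [← NNReal.tendsto_coe]
  simpa [Function.comp_def] using h_real

theorem map_smul_balanced [TopologicalSpace E] [ContinuousSMul ℝ≥0 E] [TopologicalSpace F]
    [ContinuousSMul ℝ≥0 F] [TopologicalSpace M] [T2Space M] (B : E →+ F →+ M)
    (h_left : ∀ y, Continuous fun x => B x y) (h_right : ∀ x, Continuous (B x)) (r : ℝ≥0)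
    (x : E) (y : F) : B (r • x) y = B x (r • y) := by
  have h_left' : Continuous fun r : ℝ≥0 => B (r • x) y :=
    (h_left y).comp (continuous_id.smul continuous_const)
  have h_right' : Continuous fun r : ℝ≥0 => B x (r • y) :=
    (h_right x).comp (continuous_id.smul continuous_const)
  have h_lim := tendsto_natFloor_mul_div_atTop r
  refine tendsto_nhds_unique_of_eventuallyEq ((h_left'.tendsto r).comp h_lim)
    ((h_right'.tendsto r).comp h_lim) ?_
  filter_upwards [Filter.eventually_ne_atTop 0] with n hn
  exact map_natCast_div_smul_balanced B _ hn x y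

end Balanced

namespace IsFrechetPolynomial

variable {M : Type*} [AddCommGroup M] {n : ℕ} {f : ℝ≥0 → M}

/-- The coefficient of degree `n + 1` of a Fréchet polynomial of degree at most `n + 1`,
as a function of `b = a ^ (n + 1)`. -/
def leadingCoeff (h : IsFrechetPolynomial (n + 1) f) : ℝ≥0 →+ M where
  toFun b := mixedDiff ((b / (n + 1)!) ::ₘ Multiset.replicate n 1) f 0
  map_zero' := by rw [zero_div, mixedDiff_zero_cons, Pi.zero_apply]
  map_add' b c := by
    rw [add_div]
    exact h.mixedDiff_add_cons (Multiset.card_replicate n 1) _ _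

theorem leadingCoeff_apply (h : IsFrechetPolynomial (n + 1) f) (b : ℝ≥0) :
    h.leadingCoeff b = mixedDiff ((b / (n + 1)!) ::ₘ Multiset.replicate n 1) f 0 :=
  rfl

variable [TopologicalSpace M] [IsTopologicalAddGroup M] [T2Space M]

theorem mixedDiff_cons_cons_mul (h : IsFrechetPolynomial (n + 2) f) (hf : Continuous f)
    {s : Multiset ℝ≥0} (hs : s.card = n) (a b : ℝ≥0) :
    mixedDiff (a ::ₘ b ::ₘ s) f 0 = mixedDiff ((a * b) ::ₘ 1 ::ₘ s) f 0 := by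
  have h_cont (t : Multiset ℝ≥0) : Continuous fun c => mixedDiff (c ::ₘ t) f 0 :=
    (continuous_mixedDiff_cons_zero (f := fun a (_ : Unit) => f a)
        (hf.comp continuous_fst) t).comp
      (continuous_id.prodMk (continuous_const (y := ())))
  have h_right (a : ℝ≥0) : Continuous (h.topDiff s hs a) := by
    change Continuous fun b => mixedDiff (a ::ₘ b ::ₘ s) f 0
    simpa only [Multiset.cons_swap a] using h_cont (a ::ₘ s)
  have h_balanced := map_smul_balanced (h.topDiff s hs) (fun b => h_cont (b ::ₘ s)) h_right b a 1
  simp only [smul_eq_mul, mul_one, mul_comm b a] at h_balanced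
  exact h_balanced.symm

theorem mixedDiff_cons_eq_prod (h : IsFrechetPolynomial (n + 1) f) (hf : Continuous f)
    {s : Multiset ℝ≥0} (hs : s.card = n) (a : ℝ≥0) :
    mixedDiff (a ::ₘ s) f 0 = mixedDiff ((a * s.prod) ::ₘ Multiset.replicate n 1) f 0 := by
  suffices h_aux : ∀ s t : Multiset ℝ≥0, (s + t).card = n → ∀ a, mixedDiff (a ::ₘ (s + t)) f 0 =
      mixedDiff ((a * s.prod) ::ₘ (Multiset.replicate s.card 1 + t)) f 0 by
    simpa only [add_zero, hs] using h_aux s 0 (by rwa [add_zero]) a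
  intro s
  induction s using Multiset.induction_on with
  | empty => simp
  | cons b s ih =>
    intro t ht a
    obtain rfl : n = (s + t).card + 1 := by rw [← ht, Multiset.cons_add, Multiset.card_cons]
    rw [Multiset.cons_add, h.mixedDiff_cons_cons_mul hf rfl, ← Multiset.add_cons,
      ih _ (by rw [Multiset.add_cons, Multiset.card_cons]), Multiset.prod_cons, mul_assoc,
      Multiset.card_cons, Multiset.replicate_succ, Multiset.cons_add, Multiset.add_cons]

theorem sub_leadingCoeff (h : IsFrechetPolynomial (n + 1) f) (hf : Continuous f) :
    IsFrechetPolynomial n (f - fun a => h.leadingCoeff (a ^ (n + 1))) := by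
  intro s hs
  rw [mixedDiff_sub, Pi.sub_apply, mixedDiff_pow _ hs.ge, if_pos hs.symm, sub_eq_zero]
  obtain ⟨a, t, rfl, ht⟩ := Multiset.card_eq_succ_iff.1 hs
  rw [h.mixedDiff_cons_eq_prod hf ht, ← Multiset.prod_cons, leadingCoeff_apply,
    mul_div_cancel_left₀ _ (Nat.cast_ne_zero.2 (Nat.factorial_ne_zero _))]

end IsFrechetPolynomial

section Expansions

variable {M : Type*} [AddCommGroup M] {d : ℕ} {f : ℝ≥0 → M}

namespace IsPolynomialExpansion

theorem snoc {c : Fin (d + 1) → ℝ≥0 → M} {g : ℝ≥0 →+ M}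
    (h : IsPolynomialExpansion (f - fun a => g (a ^ (d + 1))) c) :
    IsPolynomialExpansion (d := d + 1) f (Fin.snoc (α := fun _ => ℝ≥0 → M) c g) := by
  obtain ⟨h_const, h_add, h_eq⟩ := h
  refine ⟨h_const, fun i => ?_, fun a => ?_⟩
  · induction i using Fin.lastCases with
    | last => simp
    | cast i =>
      intro hi
      simpa using h_add i (Fin.castSucc_ne_zero_iff.1 hi)
  · rw [Fin.sum_univ_castSucc]
    simp [← h_eq]

theorem mixedDiff_eq {c : Fin (d + 1) → ℝ≥0 → M} (h : IsPolynomialExpansion f c)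
    {s : Multiset ℝ≥0} (hs : s.card = d) (x : ℝ≥0) :
    mixedDiff s f x = c (Fin.last d) (d ! * s.prod) := by
  obtain ⟨h_const, h_add, h_eq⟩ := h
  have h_term (i : Fin (d + 1)) : mixedDiff s (fun a => c i (a ^ (i : ℕ))) x =
      if i = Fin.last d then c i (d ! * s.prod) else 0 := by
    rcases eq_or_ne i 0 with rfl | hi
    · rw [show (fun a => c 0 (a ^ ((0 : Fin (d + 1)) : ℕ))) = fun _ => c 0 (d ! * s.prod) from
        funext fun a => h_const _ _]
      split_ifs with h_last
      · obtain rfl : s = 0 := Multiset.card_eq_zero.1 (hs.trans (congrArg Fin.val h_last).symm)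
        rw [mixedDiff_zero]
      · refine congrFun (mixedDiff_const ?_ _) x
        rintro rfl
        exact h_last (Fin.ext hs)
    · let ci : ℝ≥0 →+ M := ⟨⟨c i, by simpa using h_add i hi 0 0⟩, h_add i hi⟩
      have h_pow := mixedDiff_pow ci (hs.ge.trans' i.is_le) x
      have h_iff : (i : ℕ) = s.card ↔ i = Fin.last d := by rw [hs, Fin.ext_iff, Fin.val_last]
      rw [if_congr h_iff rfl rfl] at h_pow
      refine h_pow.trans (if_ctx_congr Iff.rfl ?_ fun _ => rfl)
      rintro rfl
      rfl
  rw [funext h_eq, mixedDiff_sum, Finset.sum_congr rfl fun i _ => h_term i, Finset.sum_ite_eq',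
    if_pos (Finset.mem_univ _)]

end IsPolynomialExpansion

theorem exists_isPolynomialExpansion {Y : Type*} [TopologicalSpace Y] [TopologicalSpace M]
    [IsTopologicalAddGroup M] [T2Space M] {f : ℝ≥0 → Y → M}
    (hf : Continuous fun p : ℝ≥0 × Y => f p.1 p.2)
    (h : ∀ y, IsFrechetPolynomial d fun a => f a y) :
    ∃ c : Fin (d + 1) → ℝ≥0 → Y → M,
      (∀ y, IsPolynomialExpansion (fun a => f a y) fun i a => c i a y) ∧
      ∀ i, Continuous fun p : ℝ≥0 × Y => c i p.1 p.2 := by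
  induction d generalizing f with
  | zero =>
    refine ⟨fun _ _ y => f 0 y, fun y => ⟨fun _ _ => rfl, fun i hi => ?_, fun a => ?_⟩,
      fun _ => hf.comp (continuous_const.prodMk continuous_snd)⟩
    · exact absurd (Fin.eq_zero i) hi
    · simpa [← Multiset.cons_zero, mixedDiff_cons_apply, sub_eq_zero] using h y {a} rfl
  | succ d ih =>
    let g (b : ℝ≥0) (y : Y) : M := (h y).leadingCoeff b
    have hg : Continuous fun p : ℝ≥0 × Y => g p.1 p.2 :=
      (continuous_mixedDiff_cons_zero hf (Multiset.replicate d 1)).comp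
        ((continuous_fst.div_const ((d + 1)! : ℝ≥0)).prodMk continuous_snd)
    have h_pow : Continuous fun p : ℝ≥0 × Y => g (p.1 ^ (d + 1)) p.2 :=
      hg.comp ((continuous_fst.pow _).prodMk continuous_snd)
    obtain ⟨c, hc, hc_cont⟩ := ih (f := fun a y => f a y - g (a ^ (d + 1)) y) (hf.sub h_pow)
      fun y => (h y).sub_leadingCoeff (hf.comp (continuous_id.prodMk continuous_const))
    refine ⟨Fin.snoc (α := fun _ => ℝ≥0 → Y → M) c g, fun y => ?_, fun i => ?_⟩
    · have h_snoc : (fun i a => Fin.snoc (α := fun _ => ℝ≥0 → Y → M) c g i a y) =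
          Fin.snoc (α := fun _ => ℝ≥0 → M) (fun i a => c i a y) fun a => g a y :=
        Fin.comp_snoc (fun (e : ℝ≥0 → Y → M) (a : ℝ≥0) => e a y) c g
      rw [h_snoc]
      exact (hc y).snoc
    · induction i using Fin.lastCases with
      | last => simpa only [Fin.snoc_last] using hg
      | cast i => simpa only [Fin.snoc_castSucc] using hc_cont i

namespace IsPolynomialExpansion

theorem init {c : Fin (d + 2) → ℝ≥0 → M} (h : IsPolynomialExpansion f c) :
    IsPolynomialExpansion (f - fun a => c (Fin.last (d + 1)) (a ^ (d + 1))) (Fin.init c) := by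
  obtain ⟨h_const, h_add, h_eq⟩ := h
  refine ⟨h_const, fun i hi => h_add i.castSucc (Fin.castSucc_ne_zero_iff.2 hi), fun a => ?_⟩
  simp [h_eq, Fin.sum_univ_castSucc (n := d + 1), Fin.init]

theorem last_eq_mixedDiff {c : Fin (d + 2) → ℝ≥0 → M} (h : IsPolynomialExpansion f c) (b : ℝ≥0) :
    c (Fin.last (d + 1)) b = mixedDiff ((b / (d + 1)!) ::ₘ Multiset.replicate d 1) f 0 := by
  rw [h.mixedDiff_eq (by rw [Multiset.card_cons, Multiset.card_replicate]), Multiset.prod_cons,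
    Multiset.prod_replicate, one_pow, mul_one,
    mul_div_cancel₀ _ (Nat.cast_ne_zero.2 (Nat.factorial_ne_zero _))]

theorem unique {c c' : Fin (d + 1) → ℝ≥0 → M} (h : IsPolynomialExpansion f c)
    (h' : IsPolynomialExpansion f c') : c = c' := by
  induction d generalizing f with
  | zero =>
    funext i a
    obtain rfl := Fin.eq_zero i
    rw [h.1 a (a ^ 0), h'.1 a (a ^ 0)]
    simpa using (h.2.2 a).symm.trans (h'.2.2 a)
  | succ d ih =>
    have h_last : c (Fin.last (d + 1)) = c' (Fin.last (d + 1)) :=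
      funext fun b => (h.last_eq_mixedDiff b).trans (h'.last_eq_mixedDiff b).symm
    have h_init := h'.init
    rw [← h_last] at h_init
    rw [← Fin.snoc_init_self c, ← Fin.snoc_init_self c', ih h.init h_init, h_last]

end IsPolynomialExpansion

end Expansions

end FrechetPolynomials

namespace IsPolynomialExpansion

variable {M N : Type*} [AddCommGroup M] [AddCommGroup N] {d : ℕ} {f g : ℝ≥0 → M}
  {b c : Fin (d + 1) → ℝ≥0 → M}

theorem component_apply_zero (hf : IsPolynomialExpansion f c) {i : Fin (d + 1)} (hi : i ≠ 0) :
    c i 0 = 0 :=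
  left_eq_add.1 <| (congrArg (c i) (add_zero 0).symm).trans (hf.2.1 i hi 0 0)

theorem apply_zero (hf : IsPolynomialExpansion f c) (r : ℝ≥0) : f 0 = c 0 r := by
  rw [hf.2.2, Finset.sum_eq_single_of_mem 0 (Finset.mem_univ 0) fun i _ hi => ?_]
  · exact hf.1 _ _
  · rw [zero_pow (Fin.val_ne_zero_iff.2 hi), hf.component_apply_zero hi]

theorem add (hf : IsPolynomialExpansion f b) (hg : IsPolynomialExpansion g c) :
    IsPolynomialExpansion (fun r => f r + g r) fun i r => b i r + c i r := by
  obtain ⟨hb_const, hb_add, hf_eq⟩ := hf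
  obtain ⟨hc_const, hc_add, hg_eq⟩ := hg
  refine ⟨fun r s => congrArg₂ (· + ·) (hb_const r s) (hc_const r s), fun i hi r s => ?_,
    fun r => ?_⟩
  · simp only [hb_add i hi, hc_add i hi]
    exact add_add_add_comm ..
  · simp only [hf_eq, hg_eq, Finset.sum_add_distrib]

theorem map (hf : IsPolynomialExpansion f c) (T : M →+ N) :
    IsPolynomialExpansion (fun r => T (f r)) fun i r => T (c i r) := by
  obtain ⟨h_const, h_add, h_eq⟩ := hf
  refine ⟨fun r s => congrArg T (h_const r s), fun i hi r s => ?_, fun r => ?_⟩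
  · simp only [h_add i hi, map_add]
  · simp only [h_eq, map_sum]

theorem comp_mul_right (hf : IsPolynomialExpansion f c) (s : ℝ≥0) :
    IsPolynomialExpansion (fun r => f (r * s)) fun i r => c i (r * s ^ (i : ℕ)) := by
  obtain ⟨h_const, h_add, h_eq⟩ := hf
  refine ⟨fun r r' => h_const _ _, fun i hi r r' => ?_, fun r => ?_⟩
  · simp only [add_mul, h_add i hi]
  · simp only [h_eq, mul_pow]

theorem monomial (hf : IsPolynomialExpansion f c) (i : Fin (d + 1)) (b : ℝ≥0) :
    IsPolynomialExpansion (fun r => c i (b * r ^ (i : ℕ)))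
      fun j r => if j = i then c i (b * r) else 0 := by
  obtain ⟨h_const, h_add, -⟩ := hf
  refine ⟨fun r s => if_ctx_congr Iff.rfl ?_ fun _ => rfl, fun j hj r s => ?_, fun r => ?_⟩
  · rintro rfl
    exact h_const _ _
  · obtain rfl | h_ne := eq_or_ne j i
    · simp only [if_true, mul_add, h_add j hj]
    · simp only [if_neg h_ne, add_zero]
  · simp only [Finset.sum_ite_eq', Finset.mem_univ, if_true]

end IsPolynomialExpansion

/-- The maps `ρ₀, …, ρ_d` are the dilation components of the action `D` of the multiplicative monoid
`[0, ∞)` on `M`: each orbit map is `D(r, x) = ρ₀(x) + ρ₁(r, x) + ⋯ + ρ_d(r ^ d, x)`. -/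
structure IsPolynomialAction {M : Type*} [AddCommGroup M] {d : ℕ} (D : ℝ≥0 → M →+ M)
    (ρ : Fin (d + 1) → ℝ≥0 → M → M) : Prop where
  one_apply : ∀ x, D 1 x = x
  mul_apply : ∀ r s x, D (r * s) x = D r (D s x)
  expansion : ∀ x, IsPolynomialExpansion (fun r => D r x) fun i r => ρ i r x

namespace IsPolynomialAction

variable {M : Type*} [AddCommGroup M] {d : ℕ} {D : ℝ≥0 → M →+ M} {ρ : Fin (d + 1) → ℝ≥0 → M → M}

theorem component_add (h : IsPolynomialAction D ρ) (i : Fin (d + 1)) (r : ℝ≥0) (x y : M) :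
    ρ i r (x + y) = ρ i r x + ρ i r y := by
  have h_sum := (h.expansion x).add (h.expansion y)
  simp only [← map_add] at h_sum
  exact congrFun₂ ((h.expansion (x + y)).unique h_sum) i r

theorem action_component (h : IsPolynomialAction D ρ) (i : Fin (d + 1)) (r s : ℝ≥0) (x : M) :
    D s (ρ i r x) = ρ i (r * s ^ (i : ℕ)) x := by
  have h_map := (h.expansion x).map (D s)
  simp only [← h.mul_apply, mul_comm s] at h_map
  exact congrFun₂ (h_map.unique ((h.expansion x).comp_mul_right s)) i r

theorem component_action (h : IsPolynomialAction D ρ) (i : Fin (d + 1)) (r s : ℝ≥0) (x : M) :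
    ρ i r (D s x) = ρ i (r * s ^ (i : ℕ)) x := by
  have h_orbit := h.expansion (D s x)
  simp only [← h.mul_apply] at h_orbit
  exact congrFun₂ (h_orbit.unique ((h.expansion x).comp_mul_right s)) i r

theorem component_component (h : IsPolynomialAction D ρ) (i j : Fin (d + 1)) (r s : ℝ≥0) (x : M) :
    ρ j s (ρ i r x) = if j = i then ρ i (r * s) x else 0 := by
  have h_orbit := h.expansion (ρ i r x)
  simp only [h.action_component] at h_orbit
  exact congrFun₂ (h_orbit.unique ((h.expansion x).monomial i r)) j s

/-- The projection `e_i = ρ_i(1, -)` onto the part of `M` that is homogeneous of degree `i`. -/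
def projection (h : IsPolynomialAction D ρ) (i : Fin (d + 1)) : M →+ M :=
  AddMonoidHom.mk' (ρ i 1) (h.component_add i 1)

theorem projection_apply (h : IsPolynomialAction D ρ) (i : Fin (d + 1)) (x : M) :
    h.projection i x = ρ i 1 x :=
  rfl

theorem sum_projection (h : IsPolynomialAction D ρ) (x : M) : ∑ i, h.projection i x = x := by
  simpa only [h.one_apply, one_pow, projection_apply] using ((h.expansion x).2.2 1).symm

theorem projection_projection (h : IsPolynomialAction D ρ) (i j : Fin (d + 1)) (x : M) :
    h.projection i (h.projection j x) = if i = j then h.projection j x else 0 := by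
  simp only [projection_apply, h.component_component, mul_one]

theorem projection_component (h : IsPolynomialAction D ρ) (i : Fin (d + 1)) (r : ℝ≥0) (x : M) :
    h.projection i (ρ i r x) = ρ i r x := by
  rw [projection_apply, h.component_component, if_pos rfl, mul_one]

theorem component_one_of_mem_range (h : IsPolynomialAction D ρ) {i : Fin (d + 1)} {x : M}
    (hx : x ∈ (h.projection i).range) : ρ i 1 x = x := by
  obtain ⟨x, rfl⟩ := hx
  exact h.projection_component i 1 x

/-- The `[0, ∞)`-module structure `r • x = ρ_i(r, x)` on the image of `e_i`, for `i ≠ 0`. -/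
abbrev moduleRange (h : IsPolynomialAction D ρ) {i : Fin (d + 1)} (hi : i ≠ 0) :
    Module ℝ≥0 (h.projection i).range where
  smul r x := ⟨ρ i r x, _, h.projection_component i r x⟩
  one_smul x := Subtype.ext (h.component_one_of_mem_range x.2)
  mul_smul r s x := Subtype.ext <| by
    change ρ i (r * s) x = ρ i r (ρ i s x)
    rw [h.component_component, if_pos rfl, mul_comm]
  smul_zero r := Subtype.ext (map_zero (AddMonoidHom.mk' (ρ i r) (h.component_add i r)))
  smul_add r x y := Subtype.ext (h.component_add i r x y)
  add_smul r s x := Subtype.ext ((h.expansion x).2.1 i hi r s)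
  zero_smul x := Subtype.ext ((h.expansion x).component_apply_zero hi)

end IsPolynomialAction

section RealScalars

variable {M : Type*} [AddCommGroup M] [Module ℝ≥0 M]

theorem toNNReal_smul_sub_toNNReal_neg_smul {r : ℝ} {a b : ℝ≥0} (h : r = a - b) (x : M) :
    r.toNNReal • x - (-r).toNNReal • x = a • x - b • x := by
  have h_parts : r.toNNReal + b = a + (-r).toNNReal := by
    rw [← NNReal.coe_inj]
    push_cast [Real.coe_toNNReal', h]
    grind
  rw [sub_eq_sub_iff_add_eq_add, ← add_smul, h_parts, add_smul]

theorem toNNReal_sub_toNNReal_neg (r : ℝ) : r = r.toNNReal - (-r).toNNReal := by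
  rw [Real.coe_toNNReal', Real.coe_toNNReal']
  grind

variable (M) in
/-- The extension of an action of the semiring `[0, ∞)` on an abelian group to `ℝ`, given by
`r • x = r⁺ • x - r⁻ • x`. -/
abbrev realModuleOfNNReal : Module ℝ M where
  smul r x := r.toNNReal • x - (-r).toNNReal • x
  one_smul x := by
    change (1 : ℝ).toNNReal • x - (-1 : ℝ).toNNReal • x = x
    simp
  mul_smul r s x := by
    have h_mul : r * s = (r.toNNReal * s.toNNReal + (-r).toNNReal * (-s).toNNReal : ℝ≥0) -
        (r.toNNReal * (-s).toNNReal + (-r).toNNReal * s.toNNReal : ℝ≥0) := by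
      conv_lhs => rw [toNNReal_sub_toNNReal_neg r, toNNReal_sub_toNNReal_neg s]
      push_cast
      ring
    refine (toNNReal_smul_sub_toNNReal_neg_smul h_mul x).trans ?_
    change _ = r.toNNReal • (s.toNNReal • x - (-s).toNNReal • x) -
      (-r).toNNReal • (s.toNNReal • x - (-s).toNNReal • x)
    simp only [add_smul, mul_smul, smul_sub]
    abel
  smul_zero r := by
    change r.toNNReal • (0 : M) - (-r).toNNReal • (0 : M) = 0
    simp
  smul_add r x y := by
    change r.toNNReal • (x + y) - (-r).toNNReal • (x + y) =
      (r.toNNReal • x - (-r).toNNReal • x) + (r.toNNReal • y - (-r).toNNReal • y)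
    rw [smul_add, smul_add]
    abel
  add_smul r s x := by
    have h_add : r + s =
        (r.toNNReal + s.toNNReal : ℝ≥0) - ((-r).toNNReal + (-s).toNNReal : ℝ≥0) := by
      conv_lhs => rw [toNNReal_sub_toNNReal_neg r, toNNReal_sub_toNNReal_neg s]
      push_cast
      ring
    refine (toNNReal_smul_sub_toNNReal_neg_smul h_add x).trans ?_
    change _ = (r.toNNReal • x - (-r).toNNReal • x) + (s.toNNReal • x - (-s).toNNReal • x)
    simp only [add_smul]
    abel
  zero_smul x := by
    change (0 : ℝ).toNNReal • x - (-0 : ℝ).toNNReal • x = 0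
    simp

theorem coe_smul_realModuleOfNNReal (r : ℝ≥0) (x : M) :
    r • x = letI := realModuleOfNNReal M; (r : ℝ) • x := by
  change r • x = (r : ℝ).toNNReal • x - (-(r : ℝ)).toNNReal • x
  rw [Real.toNNReal_coe, Real.toNNReal_of_nonpos (neg_nonpos.2 r.coe_nonneg), zero_smul, sub_zero]

theorem continuousSMul_realModuleOfNNReal [TopologicalSpace M] [IsTopologicalAddGroup M]
    [ContinuousSMul ℝ≥0 M] :
    letI := realModuleOfNNReal M
    ContinuousSMul ℝ M :=
  have h_cont : Continuous fun p : ℝ × M => p.1.toNNReal • p.2 - (-p.1).toNNReal • p.2 :=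
    ((continuous_real_toNNReal.comp continuous_fst).smul continuous_snd).sub
      ((continuous_real_toNNReal.comp continuous_fst.neg).smul continuous_snd)
  letI := realModuleOfNNReal M
  ⟨h_cont⟩

end RealScalars

theorem IsPolynomialAction.exists_module_range {M : Type*} [AddCommGroup M] [TopologicalSpace M]
    [IsTopologicalAddGroup M] {d : ℕ} {D : ℝ≥0 → M →+ M} {ρ : Fin (d + 1) → ℝ≥0 → M → M}
    (h : IsPolynomialAction D ρ) {i : Fin (d + 1)} (hi : i ≠ 0)
    (h_cont : Continuous fun p : ℝ≥0 × M => ρ i p.1 p.2) :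
    ∃ _ : Module ℝ (h.projection i).range, ContinuousSMul ℝ (h.projection i).range ∧
      ∀ (r : ℝ≥0) x, (h.projection i).rangeRestrict (D r x) =
        (r : ℝ) ^ (i : ℕ) • (h.projection i).rangeRestrict x := by
  let := h.moduleRange hi
  have : ContinuousSMul ℝ≥0 (h.projection i).range :=
    ⟨(h_cont.comp (continuous_fst.prodMk (continuous_subtype_val.comp continuous_snd))).subtype_mk
      _⟩
  refine ⟨realModuleOfNNReal _, continuousSMul_realModuleOfNNReal, fun r x => ?_⟩
  rw [← NNReal.coe_pow]
  refine Eq.trans (Subtype.ext ?_) (coe_smul_realModuleOfNNReal (r ^ (i : ℕ)) _)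
  change ρ i 1 (D r x) = ρ i (r ^ (i : ℕ)) (ρ i 1 x)
  rw [h.component_action, h.component_component, if_pos rfl]

section Ranges

variable {M : Type*} [AddCommGroup M] [TopologicalSpace M]

theorem isClosed_range_of_idempotent [T2Space M] {e : M →+ M} (h_cont : Continuous e)
    (he : ∀ x, e (e x) = e x) : IsClosed (e.range : Set M) := by
  have h_range : (e.range : Set M) = {x | e x = x} :=
    Set.Subset.antisymm (by rintro _ ⟨x, rfl⟩; exact he x) fun x hx => ⟨x, hx⟩
  exact h_range ▸ isClosed_eq h_cont continuous_id

/-- The splitting `x ↦ (e_i(x))_i` of a topological abelian group by a complete system `(e_i)` of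
continuous orthogonal projections. -/
def continuousAddEquivPiRange [ContinuousAdd M] {ι : Type*} [Fintype ι] [DecidableEq ι]
    (e : ι → M →+ M) (h_cont : ∀ i, Continuous (e i))
    (he : ∀ i j x, e i (e j x) = if i = j then e j x else 0) (h_sum : ∀ x, ∑ i, e i x = x) :
    M ≃ₜ+ ((i : ι) → (e i).range) where
  toFun x i := (e i).rangeRestrict x
  invFun y := ∑ i, (y i : M)
  left_inv := h_sum
  right_inv y := by
    have h_apply (i j : ι) : e i (y j) = if i = j then (y j : M) else 0 := by
      obtain ⟨x, hx⟩ := (y j).2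
      rw [← hx, he]
    refine funext fun i => Subtype.ext ?_
    rw [AddMonoidHom.coe_rangeRestrict, map_sum]
    simp only [h_apply, Finset.sum_ite_eq, Finset.mem_univ, if_true]
  map_add' x y := funext fun i => map_add (e i).rangeRestrict x y
  continuous_toFun := continuous_pi fun i => (h_cont i).subtype_mk _
  continuous_invFun := continuous_finsetSum _ fun i _ =>
    continuous_subtype_val.comp (continuous_apply i)

theorem exists_int_continuousAddEquiv_range {e : M →+ M} {χ : M →+ ℤ} {p : M}
    (h_cont : Continuous χ) (hp : χ p = 1) (he : ∀ x, e x = χ x • p) :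
    ∃ β : ℤ ≃ₜ+ e.range, (β 1 : M) = p := by
  have h_mem (n : ℤ) : n • p ∈ e.range := ⟨n • p, by rw [he, map_zsmul, hp, smul_eq_mul, mul_one]⟩
  refine ⟨{ toFun := fun n => ⟨n • p, h_mem n⟩
            invFun := fun x => χ x
            left_inv := fun n => ?_
            right_inv := ?_
            map_add' := fun m n => Subtype.ext (add_zsmul p m n)
            continuous_toFun := continuous_of_discreteTopology
            continuous_invFun := h_cont.comp continuous_subtype_val }, one_zsmul p⟩
  · simp only [map_zsmul, hp, smul_eq_mul, mul_one]
  · rintro ⟨_, x, rfl⟩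
    simp only [he, map_zsmul, hp, smul_eq_mul, mul_one]

end Ranges

section HausdorffMetric

variable {V : Type*} [NormedAddCommGroup V] [NormedSpace ℝ V] {K L : ConvexBody V}

theorem exists_mem_dist_le_dist_convexBody {x : V} (hx : x ∈ K) : ∃ y ∈ L, dist x y ≤ dist K L := by
  obtain ⟨y, hy, hxy⟩ := L.isCompact.exists_infDist_eq_dist L.nonempty x
  exact ⟨y, hy, hxy ▸ Metric.infDist_le_hausdorffDist_of_mem hx ConvexBody.hausdorffEDist_ne_top⟩

theorem dist_convexBody_le {C : ℝ} (hC : 0 ≤ C) (hKL : ∀ x ∈ K, ∃ y ∈ L, dist x y ≤ C)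
    (hLK : ∀ y ∈ L, ∃ x ∈ K, dist y x ≤ C) : dist K L ≤ C :=
  Metric.hausdorffDist_le_of_mem_dist hC hKL hLK

theorem dist_smul_convexBody_le (r : ℝ≥0) (K L : ConvexBody V) :
    dist (r • K) (r • L) ≤ r * dist K L := by
  have h_near (K L : ConvexBody V) : ∀ x ∈ r • K, ∃ y ∈ r • L, dist x y ≤ r * dist K L := by
    rintro _ ⟨x, hx, rfl⟩
    obtain ⟨y, hy, hxy⟩ := exists_mem_dist_le_dist_convexBody hx
    refine ⟨r • y, Set.smul_mem_smul_set hy, (dist_smul_le _ _ _).trans ?_⟩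
    rw [NNReal.norm_eq]
    gcongr
  exact dist_convexBody_le (by positivity) (h_near K L) (dist_comm K L ▸ h_near L K)

theorem dist_smul_smul_convexBody_le (r s : ℝ≥0) {C : ℝ} (hC : 0 ≤ C) (hK : ∀ x ∈ K, ‖x‖ ≤ C) :
    dist (r • K) (s • K) ≤ dist r s * C := by
  have h_near (r s : ℝ≥0) : ∀ x ∈ r • K, ∃ y ∈ s • K, dist x y ≤ dist r s * C := by
    rintro _ ⟨x, hx, rfl⟩
    refine ⟨s • x, Set.smul_mem_smul_set hx, (dist_pair_smul _ _ _).trans ?_⟩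
    rw [dist_zero_right]
    exact mul_le_mul_of_nonneg_left (hK x hx) dist_nonneg
  exact dist_convexBody_le (by positivity) (h_near r s) (dist_comm r s ▸ h_near s r)

instance continuousSMul_convexBody : ContinuousSMul ℝ≥0 (ConvexBody V) := by
  refine ⟨continuous_iff_continuousAt.2 fun ⟨s, K⟩ => ?_⟩
  obtain ⟨C, hC, hK⟩ := K.isBounded.exists_pos_norm_le
  have h_bound : Continuous fun p : ℝ≥0 × ConvexBody V => p.1 * dist p.2 K + dist p.1 s * C := by
    fun_prop
  refine tendsto_iff_dist_tendsto_zero.2 (squeeze_zero (fun _ => dist_nonneg) (fun p => ?_)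
    (h_bound.tendsto' (s, K) 0 (by simp)))
  exact (dist_triangle _ (p.1 • K) _).trans
    (add_le_add (dist_smul_convexBody_le ..) (dist_smul_smul_convexBody_le _ _ hC.le hK))

/-- The polytope spanned by a nonempty finite set of points. -/
def polytope (t : Finset V) (ht : t.Nonempty) : ConvexBody V where
  carrier := convexHull ℝ t
  convex' := convex_convexHull ℝ _
  isCompact' := t.finite_toSet.isCompact_convexHull ℝ
  nonempty' := ht.to_set.convexHull

theorem dense_polytopes : Dense {K : ConvexBody V | ∃ t ht, polytope t ht = K} := by
  refine Metric.dense_iff.2 fun K ε hε => ?_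
  obtain ⟨t, htK, ht_fin, h_cover⟩ := K.isCompact.finite_cover_balls (half_pos hε)
  lift t to Finset V using ht_fin
  obtain ⟨x, hx⟩ := K.nonempty
  obtain ⟨y, hy, -⟩ := Set.mem_iUnion₂.1 (h_cover hx)
  refine ⟨polytope t ⟨y, hy⟩, ?_, t, _, rfl⟩
  refine (dist_convexBody_le (half_pos hε).le (fun x hx => ⟨x, ?_, ?_⟩) fun x hx => ?_).trans_lt
    (half_lt_self hε)
  · exact convexHull_min htK K.convex hx
  · rw [dist_self]
    exact (half_pos hε).le
  · obtain ⟨y, hy, hxy⟩ := Set.mem_iUnion₂.1 (h_cover hx)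
    exact ⟨y, subset_convexHull ℝ _ hy, (Metric.mem_ball.1 hxy).le⟩

end HausdorffMetric

section Valuations

variable {V : Type*} [NormedAddCommGroup V] [NormedSpace ℝ V] {A B : Type*} [AddCommGroup A]
  [AddCommGroup B] {φ : ConvexBody V → A}

theorem IsValuation.map (h : IsValuation φ) (f : A →+ B) : IsValuation fun K => f (φ K) := by
  intro K L U I hU hI
  simp only [h K L U I hU hI, map_sub, map_add]

theorem IsAffineInvariant.map [FiniteDimensional ℝ V] {G : Subgroup (V ≃ᵃ[ℝ] V)}
    (h : IsAffineInvariant G φ) (f : A →+ B) : IsAffineInvariant G fun K => f (φ K) :=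
  fun g hg K => congrArg f (h g hg K)

theorem IsValuation.smul (h : IsValuation φ) (r : ℝ≥0) : IsValuation fun K => φ (r • K) := by
  intro K L U I hU hI
  obtain rfl | hr := eq_or_ne r 0
  · simp only [zero_smul, add_sub_cancel_right]
  · refine h _ _ _ _ ?_ ?_
    · simp only [ConvexBody.coe_smul', hU, Set.smul_set_union]
    · simp only [ConvexBody.coe_smul', hI, Set.smul_set_inter₀ hr]

theorem IsValuation.mixedDiff_smul (h : IsValuation φ) (s : Multiset ℝ≥0) (r : ℝ≥0) :
    IsValuation fun K => mixedDiff s (fun r => φ (r • K)) r := by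
  have h_family : IsValuation fun K (r : ℝ≥0) => φ (r • K) := fun K L U I hU hI =>
    funext fun r => h.smul r K L U I hU hI
  exact h_family.map (AddMonoidHom.ofMapSub (mixedDiff s · r) fun f g =>
    congrFun (mixedDiff_sub s f g) r)

end Valuations

namespace FreeTAG

variable {X A : Type*} [AddCommGroup A]

theorem continuous_of [TopologicalSpace X] : Continuous (of : X → FreeTAG X) := by
  refine continuous_iff_coinduced_le.2 ?_
  change _ ≤ (groupTopology X).toTopologicalSpace
  rw [groupTopology, AddGroupTopology.toTopologicalSpace_sInf]
  refine le_sInf ?_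
  rintro _ ⟨t, ht, rfl⟩
  exact continuous_iff_coinduced_le.1 ht

/-- The homomorphism on the free abelian group that extends a map on the generators. -/
def lift (f : X → A) : FreeTAG X →+ A :=
  FreeAbelianGroup.lift f

theorem lift_of (f : X → A) (x : X) : lift f (of x) = f x :=
  FreeAbelianGroup.lift_apply_of f x

theorem continuous_lift [TopologicalSpace X] [τ : TopologicalSpace A] [IsTopologicalAddGroup A]
    {f : X → A} (hf : Continuous f) : Continuous (lift f) := by
  let t : AddGroupTopology (FreeTAG X) :=
    ⟨TopologicalSpace.induced (lift f) τ, topologicalAddGroup_induced (lift f)⟩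
  have ht : groupTopology X ≤ t :=
    sInf_le (continuous_induced_rng.2 (by simpa only [Function.comp_def, lift_of] using hf))
  exact continuous_iff_le_induced.2 (AddGroupTopology.toTopologicalSpace_le.2 ht)

end FreeTAG

theorem FreeHTAG.exists_lift {X A : Type*} [TopologicalSpace X] [AddCommGroup A]
    [TopologicalSpace A] [IsTopologicalAddGroup A] [T2Space A] {f : X → A} (hf : Continuous f) :
    ∃ F : FreeHTAG X →+ A, Continuous F ∧ ∀ x, F (of x) = f x := by
  have h_cont : Continuous (FreeTAG.lift f) := FreeTAG.continuous_lift hf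
  have h_ker : (⊥ : AddSubgroup (FreeTAG X)).topologicalClosure ≤ (FreeTAG.lift f).ker :=
    AddSubgroup.topologicalClosure_minimal _ bot_le (isClosed_singleton.preimage h_cont)
  exact ⟨QuotientAddGroup.lift _ _ h_ker, h_cont.quotient_lift _, FreeTAG.lift_of f⟩

section UniversalValuation

variable {V : Type*} [NormedAddCommGroup V] [NormedSpace ℝ V] [FiniteDimensional ℝ V]
  (G : Subgroup (V ≃ᵃ[ℝ] V))

theorem continuous_universalValuation : Continuous (universalValuation G) :=
  continuous_quot_mk.comp (continuous_quot_mk.comp FreeTAG.continuous_of)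

variable {G} in
theorem mk_eq_zero_of_mem_convexBodyRelations {z : FreeHTAG (ConvexBody V)}
    (hz : z ∈ convexBodyRelations G) : (QuotientAddGroup.mk z : CB V G) = 0 :=
  (QuotientAddGroup.eq_zero_iff _).2
    (AddSubgroup.le_topologicalClosure _ (AddSubgroup.subset_closure hz))

theorem isValuation_universalValuation : IsValuation (universalValuation G) := by
  intro B C U I hU hI
  have h_rel : universalValuation G U - universalValuation G B - universalValuation G C +
      universalValuation G I = 0 :=
    mk_eq_zero_of_mem_convexBodyRelations (Or.inl ⟨B, C, U, I, hU, hI, rfl⟩)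
  rw [← sub_eq_zero, ← h_rel]
  abel

theorem isAffineInvariant_universalValuation : IsAffineInvariant G (universalValuation G) := by
  intro g hg K
  have h_rel : universalValuation G K - universalValuation G (affineImage g K) = 0 :=
    mk_eq_zero_of_mem_convexBodyRelations (Or.inr ⟨g, hg, K, rfl⟩)
  exact (sub_eq_zero.1 h_rel).symm

namespace CB

instance instT2Space : T2Space (CB V G) := by
  have := AddSubgroup.isClosed_topologicalClosure (AddSubgroup.closure (convexBodyRelations G))
  have := QuotientAddGroup.instT3Space
    (AddSubgroup.closure (convexBodyRelations G)).topologicalClosure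
  infer_instance

variable {G}

theorem hom_ext {A : Type*} [AddCommGroup A] {f g : CB V G →+ A}
    (h : ∀ X, f (universalValuation G X) = g (universalValuation G X)) : f = g :=
  QuotientAddGroup.addMonoidHom_ext _ <| QuotientAddGroup.addMonoidHom_ext _ <|
    FreeAbelianGroup.lift_ext _ _ h

theorem exists_lift {A : Type*} [AddCommGroup A] [TopologicalSpace A] [IsTopologicalAddGroup A]
    [T2Space A] {φ : ConvexBody V → A} (h_cont : Continuous φ) (h_val : IsValuation φ)
    (h_inv : IsAffineInvariant G φ) :
    ∃ F : CB V G →+ A, Continuous F ∧ ∀ X, F (universalValuation G X) = φ X := by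
  obtain ⟨F, hF, hF_of⟩ := FreeHTAG.exists_lift h_cont
  have h_rel : AddSubgroup.closure (convexBodyRelations G) ≤ F.ker := by
    rw [AddSubgroup.closure_le]
    rintro z (⟨B, C, U, I, hU, hI, rfl⟩ | ⟨g, hg, K, rfl⟩)
    · simp only [SetLike.mem_coe, AddMonoidHom.mem_ker, map_add, map_sub, hF_of,
        h_val B C U I hU hI]
      abel
    · simp only [SetLike.mem_coe, AddMonoidHom.mem_ker, map_sub, hF_of, h_inv g hg K, sub_self]
  have h_ker : (AddSubgroup.closure (convexBodyRelations G)).topologicalClosure ≤ F.ker :=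
    AddSubgroup.topologicalClosure_minimal _ h_rel (isClosed_singleton.preimage hF)
  exact ⟨QuotientAddGroup.lift _ F h_ker, hF.quotient_lift _, hF_of⟩

end CB

end UniversalValuation

section SetValuations

variable {E F A : Type*} [NormedAddCommGroup E] [NormedSpace ℝ E] [NormedAddCommGroup F]
  [NormedSpace ℝ F] [AddCommGroup A]

/-- The sets underlying convex bodies. -/
structure IsConvexBody (s : Set E) : Prop where
  convex : Convex ℝ s
  isCompact : IsCompact s
  nonempty : s.Nonempty

namespace IsConvexBody

theorem coe (K : ConvexBody E) : IsConvexBody (K : Set E) :=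
  ⟨K.convex, K.isCompact, K.nonempty⟩

variable {s t : Set E}

theorem inter (hs : IsConvexBody s) (h_convex : Convex ℝ t) (h_closed : IsClosed t)
    (h_ne : (s ∩ t).Nonempty) : IsConvexBody (s ∩ t) :=
  ⟨hs.convex.inter h_convex, hs.isCompact.inter_right h_closed, h_ne⟩

theorem image (hs : IsConvexBody s) (L : E →L[ℝ] F) : IsConvexBody (L '' s) :=
  ⟨hs.convex.linear_image L.toLinearMap, hs.isCompact.image L.continuous, hs.nonempty.image L⟩

open scoped Pointwise in
theorem smul (hs : IsConvexBody s) (c : ℝ) : IsConvexBody (c • s) :=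
  ⟨hs.convex.smul c, hs.isCompact.smul c, hs.nonempty.smul_set⟩

theorem exists_mem_segment_inter (hs : IsConvexBody s) (ht : IsConvexBody t)
    (hst : Convex ℝ (s ∪ t)) {x y : E} (hx : x ∈ s) (hy : y ∈ t) :
    ∃ z ∈ segment ℝ x y, z ∈ s ∩ t :=
  isPreconnected_closed_iff.1 (convex_segment x y).isPreconnected s t hs.isCompact.isClosed
    ht.isCompact.isClosed (hst.segment_subset (Or.inl hx) (Or.inr hy))
    ⟨x, left_mem_segment ℝ x y, hx⟩ ⟨y, right_mem_segment ℝ x y, hy⟩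

theorem image_inter_of_convex_union (hs : IsConvexBody s) (ht : IsConvexBody t)
    (hst : Convex ℝ (s ∪ t)) (L : E →ₗ[ℝ] F) : L '' (s ∩ t) = L '' s ∩ L '' t := by
  refine (Set.image_inter_subset _ _ _).antisymm ?_
  rintro _ ⟨⟨x, hx, rfl⟩, ⟨y, hy, hxy⟩⟩
  obtain ⟨_, ⟨a, b, -, -, hab, rfl⟩, hz⟩ := exists_mem_segment_inter hs ht hst hx hy
  exact ⟨_, hz, by rw [map_add, map_smul, map_smul, hxy, ← add_smul, hab, one_smul]⟩

end IsConvexBody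

/-- Valuations as functions of sets; only their values on convex bodies matter. -/
def IsSetValuation (ψ : Set E → A) : Prop :=
  ∀ ⦃s t⦄, IsConvexBody s → IsConvexBody t → Convex ℝ (s ∪ t) → ψ (s ∪ t) = ψ s + ψ t - ψ (s ∩ t)

open Classical in
/-- The extension of a function on convex bodies to all sets, by zero. -/
def setExtension (φ : ConvexBody E → A) (s : Set E) : A :=
  if h : IsConvexBody s then φ ⟨s, h.convex, h.isCompact, h.nonempty⟩ else 0

theorem setExtension_coe (φ : ConvexBody E → A) (K : ConvexBody E) :
    setExtension φ (K : Set E) = φ K :=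
  dif_pos (IsConvexBody.coe K)

theorem IsValuation.isSetValuation {φ : ConvexBody E → A} (hφ : IsValuation φ) :
    IsSetValuation (setExtension φ) := by
  intro s t hs ht hst
  obtain ⟨x, hx⟩ := hs.nonempty
  obtain ⟨y, hy⟩ := ht.nonempty
  obtain ⟨z, -, hz⟩ := hs.exists_mem_segment_inter ht hst hx hy
  have h_union : IsConvexBody (s ∪ t) := ⟨hst, hs.isCompact.union ht.isCompact, hs.nonempty.inl⟩
  have h_inter : IsConvexBody (s ∩ t) := hs.inter ht.convex ht.isCompact.isClosed ⟨z, hz⟩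
  simp only [setExtension, dif_pos hs, dif_pos ht, dif_pos h_union, dif_pos h_inter]
  exact hφ _ _ _ _ rfl rfl

namespace IsSetValuation

theorem comp_image {ψ : Set F → A} (hψ : IsSetValuation ψ) (L : E →L[ℝ] F) :
    IsSetValuation fun s => ψ (L '' s) := by
  intro s t hs ht hst
  have h_inter : L '' (s ∩ t) = L '' s ∩ L '' t :=
    hs.image_inter_of_convex_union ht hst L.toLinearMap
  simp only [h_inter, Set.image_union]
  refine hψ (hs.image L) (ht.image L) ?_
  rw [← Set.image_union]
  exact hst.linear_image L.toLinearMap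

theorem eq_add_sub_of_mem {ψ : Set E → A} (hψ : IsSetValuation ψ) {s : Set E}
    (hs : IsConvexBody s) {q : E} (hq : q ∈ s) (h : E →L[ℝ] ℝ) :
    ψ s = ψ (s ∩ {x | h q ≤ h x}) + ψ (s ∩ {x | h x ≤ h q}) - ψ (s ∩ {x | h x = h q}) := by
  have h_ge : IsConvexBody (s ∩ {x | h q ≤ h x}) :=
    hs.inter (convex_halfSpace_ge h.toLinearMap.isLinear _)
      (isClosed_le continuous_const h.continuous) ⟨q, hq, le_refl (h q)⟩
  have h_le : IsConvexBody (s ∩ {x | h x ≤ h q}) :=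
    hs.inter (convex_halfSpace_le h.toLinearMap.isLinear _)
      (isClosed_le h.continuous continuous_const) ⟨q, hq, le_refl (h q)⟩
  have h_union : (s ∩ {x | h q ≤ h x}) ∪ (s ∩ {x | h x ≤ h q}) = s := by
    rw [← Set.inter_union_distrib_left, Set.inter_eq_left]
    exact fun x _ => le_total (h q) (h x)
  have h_inter : (s ∩ {x | h q ≤ h x}) ∩ (s ∩ {x | h x ≤ h q}) = s ∩ {x | h x = h q} := by
    rw [← Set.inter_inter_distrib_left]
    exact congrArg (s ∩ ·) <|
      Set.ext fun x => ⟨fun hx => hx.2.antisymm hx.1, fun hx => ⟨hx.ge, hx.le⟩⟩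
  have h_val := hψ h_ge h_le (h_union.symm ▸ hs.convex)
  rwa [h_union, h_inter] at h_val

end IsSetValuation

end SetValuations

section InclusionExclusion

variable {E κ A : Type*} [AddCommGroup A]

/-- The failure of inclusion–exclusion for `ψ` on `s` and the sets `C i`, `i ∈ W`. -/
def coverDefect (ψ : Set E → A) (W : Finset κ) (C : κ → Set E) (s : Set E) : A :=
  ∑ S ∈ W.powerset, (-1 : ℤ) ^ S.card • ψ (s ∩ ⋂ i ∈ S, C i)

theorem coverDefect_eq_zero_of_subset (ψ : Set E → A) {W : Finset κ} {C : κ → Set E} {s : Set E}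
    {i : κ} (hi : i ∈ W) (h_sub : s ⊆ C i) : coverDefect ψ W C s = 0 := by
  classical
  rw [coverDefect, ← Finset.insert_erase hi,
    Finset.sum_powerset_insert (Finset.notMem_erase i W), ← Finset.sum_add_distrib]
  refine Finset.sum_eq_zero fun S hS => ?_
  have h_notMem : i ∉ S := fun hiS => Finset.notMem_erase i W (Finset.mem_powerset.1 hS hiS)
  rw [Finset.card_insert_of_notMem h_notMem, Finset.set_biInter_insert, ← Set.inter_assoc,
    Set.inter_eq_left.2 h_sub, pow_succ, mul_neg_one, neg_smul, add_neg_cancel]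

variable [NormedAddCommGroup E] [NormedSpace ℝ E]

/-- The polyhedral cone with apex `q` on which the forms in `H` are minimal at `q`. -/
def polyhedralCone (q : E) (H : Set (E →L[ℝ] ℝ)) : Set E :=
  {x | ∀ h ∈ H, h q ≤ h x}

theorem apex_mem_polyhedralCone (q : E) (H : Set (E →L[ℝ] ℝ)) : q ∈ polyhedralCone q H :=
  fun _ _ => le_rfl

theorem convex_polyhedralCone (q : E) (H : Set (E →L[ℝ] ℝ)) : Convex ℝ (polyhedralCone q H) := by
  simp only [polyhedralCone, Set.ofPred_forall]
  exact convex_iInter₂ fun h _ => convex_halfSpace_ge h.toLinearMap.isLinear _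

theorem isClosed_polyhedralCone (q : E) (H : Set (E →L[ℝ] ℝ)) :
    IsClosed (polyhedralCone q H) := by
  simp only [polyhedralCone, Set.ofPred_forall]
  exact isClosed_biInter fun h _ => isClosed_le continuous_const h.continuous

theorem exists_mem_forall_lt {s : Set E} (hs : Convex ℝ s) {q : E} (hq : q ∈ s) {W : Finset κ}
    {h : κ → E →L[ℝ] ℝ} (h_le : ∀ i ∈ W, ∀ x ∈ s, h i x ≤ h i q)
    (h_lt : ∀ i ∈ W, ∃ x ∈ s, h i x < h i q) : ∃ x ∈ s, ∀ i ∈ W, h i x < h i q := by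
  induction W using Finset.cons_induction with
  | empty => exact ⟨q, hq, fun i hi => absurd hi (Finset.notMem_empty i)⟩
  | cons j W hj ih =>
    rw [Finset.forall_mem_cons] at h_le h_lt
    obtain ⟨x, hx, hx_lt⟩ := h_lt.1
    obtain ⟨y, hy, hy_lt⟩ := ih h_le.2 h_lt.2
    have h_mid (i : κ) : h i (midpoint ℝ x y) = (h i x + h i y) / 2 := by
      rw [midpoint_eq_smul_add, map_smul, map_add, smul_eq_mul, invOf_eq_inv]
      ring
    refine ⟨midpoint ℝ x y, hs.midpoint_mem hx hy, Finset.forall_mem_cons _ _ |>.2 ⟨?_, ?_⟩⟩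
    · linarith [h_mid j, h_le.1 y hy]
    · intro i hi
      linarith [h_mid i, h_le.2 i hi x hx, hy_lt i hi]

variable {ψ : Set E → A}

namespace IsSetValuation

theorem coverDefect_eq_add_sub (hψ : IsSetValuation ψ) {s : Set E} (hs : IsConvexBody s) {q : E}
    (hq : q ∈ s) (W : Finset κ) {C : κ → Set E} (h_convex : ∀ i, Convex ℝ (C i))
    (h_closed : ∀ i, IsClosed (C i)) (hqC : ∀ i, q ∈ C i) (h : E →L[ℝ] ℝ) :
    coverDefect ψ W C s = coverDefect ψ W C (s ∩ {x | h q ≤ h x}) +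
      coverDefect ψ W C (s ∩ {x | h x ≤ h q}) - coverDefect ψ W C (s ∩ {x | h x = h q}) := by
  simp only [coverDefect, ← Finset.sum_add_distrib, ← Finset.sum_sub_distrib, ← smul_add,
    ← smul_sub]
  refine Finset.sum_congr rfl fun S _ => congrArg _ ?_
  have hqS : q ∈ s ∩ ⋂ i ∈ S, C i := ⟨hq, Set.mem_iInter₂.2 fun i _ => hqC i⟩
  have h_body : IsConvexBody (s ∩ ⋂ i ∈ S, C i) := hs.inter
    (convex_iInter₂ fun i _ => h_convex i) (isClosed_biInter fun i _ => h_closed i) ⟨q, hqS⟩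
  rw [hψ.eq_add_sub_of_mem h_body hqS h]
  simp only [Set.inter_right_comm s]

theorem coverDefect_polyhedralCone_eq_zero_of_semidefinite {s : Set E} (hs : Convex ℝ s) {q : E}
    (hq : q ∈ s) {W : Finset κ} {H : κ → Set (E →L[ℝ] ℝ)}
    (h_cover : s ⊆ ⋃ i ∈ W, polyhedralCone q (H i))
    (h_semidef : ∀ i ∈ W, ∀ h ∈ H i, (∀ x ∈ s, h q ≤ h x) ∨ ∀ x ∈ s, h x ≤ h q) :
    coverDefect ψ W (fun i => polyhedralCone q (H i)) s = 0 := by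
  by_cases h_sub : ∃ i ∈ W, s ⊆ polyhedralCone q (H i)
  · obtain ⟨i, hi, h_sub⟩ := h_sub
    exact coverDefect_eq_zero_of_subset ψ hi h_sub
  · have h_form : ∀ i : κ, ∃ h : E →L[ℝ] ℝ,
        i ∈ W → h ∈ H i ∧ (∀ x ∈ s, h x ≤ h q) ∧ ∃ x ∈ s, h x < h q := by
      intro i
      by_cases hi : i ∈ W
      · obtain ⟨x, hx, hx_notMem⟩ := Set.not_subset.1 fun h_sub' => h_sub ⟨i, hi, h_sub'⟩
        obtain ⟨h, hh, h_lt⟩ : ∃ h ∈ H i, h x < h q := by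
          simpa only [polyhedralCone, Set.mem_ofPred_eq, not_forall, not_le, exists_prop]
            using hx_notMem
        exact ⟨h, fun _ => ⟨hh, (h_semidef i hi h hh).resolve_left
          fun h_ge => (h_ge x hx).not_gt h_lt, x, hx, h_lt⟩⟩
      · exact ⟨0, fun hi' => absurd hi' hi⟩
    choose h h_spec using h_form
    obtain ⟨x, hx, hx_lt⟩ := exists_mem_forall_lt hs hq (fun i hi => (h_spec i hi).2.1)
      fun i hi => (h_spec i hi).2.2
    obtain ⟨i, hi, hx_cone⟩ := Set.mem_iUnion₂.1 (h_cover hx)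
    exact absurd (hx_cone (h i) (h_spec i hi).1) (hx_lt i hi).not_ge

/-- Cutting along hyperplanes through the apex reduces the claim to bodies on which no form that
defines a cone changes its sign relative to the apex; one of the cones contains such a body. -/
theorem coverDefect_polyhedralCone_eq_zero (hψ : IsSetValuation ψ) {s : Set E} (hs : IsConvexBody s)
    {q : E} (hq : q ∈ s) {W : Finset κ} {H : κ → Set (E →L[ℝ] ℝ)} (hH : ∀ i ∈ W, (H i).Finite)
    (h_cover : s ⊆ ⋃ i ∈ W, polyhedralCone q (H i)) :
    coverDefect ψ W (fun i => polyhedralCone q (H i)) s = 0 := by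
  suffices h_ind : ∀ U : Set (E →L[ℝ] ℝ), U.Finite → ∀ s, IsConvexBody s → q ∈ s →
      s ⊆ ⋃ i ∈ W, polyhedralCone q (H i) →
      (∀ i ∈ W, ∀ h ∈ H i, h ∉ U → (∀ x ∈ s, h q ≤ h x) ∨ ∀ x ∈ s, h x ≤ h q) →
      coverDefect ψ W (fun i => polyhedralCone q (H i)) s = 0 from
    h_ind _ (W.finite_toSet.biUnion hH) s hs hq h_cover fun i hi h hh h_notMem =>
      absurd (Set.mem_biUnion hi hh) h_notMem
  intro U hU
  induction U, hU using Set.Finite.induction_on with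
  | empty =>
    intro s hs hq h_cover h_semidef
    exact coverDefect_polyhedralCone_eq_zero_of_semidefinite hs.convex hq h_cover
      fun i hi h hh => h_semidef i hi h hh (Set.notMem_empty h)
  | @insert g U _ _ ih =>
    intro s hs hq h_cover h_semidef
    have h_piece {t : Set E} (ht : Convex ℝ t) (ht_closed : IsClosed t) (hqt : q ∈ t)
        (h_sign : (∀ x ∈ t, g q ≤ g x) ∨ ∀ x ∈ t, g x ≤ g q) :
        coverDefect ψ W (fun i => polyhedralCone q (H i)) (s ∩ t) = 0 := by
      refine ih _ (hs.inter ht ht_closed ⟨q, hq, hqt⟩) ⟨hq, hqt⟩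
        (Set.inter_subset_left.trans h_cover) fun i hi h hh hhU => ?_
      obtain rfl | h_ne := eq_or_ne h g
      · exact h_sign.imp (fun h_ge x hx => h_ge x hx.2) fun h_le x hx => h_le x hx.2
      · exact (h_semidef i hi h hh fun h_mem => (Set.mem_insert_iff.1 h_mem).elim h_ne hhU).imp
          (fun h_ge x hx => h_ge x hx.1) fun h_le x hx => h_le x hx.1
    have h_lin := g.toLinearMap.isLinear
    rw [hψ.coverDefect_eq_add_sub hs hq W (fun i => convex_polyhedralCone q (H i))
        (fun i => isClosed_polyhedralCone q (H i)) (fun i => apex_mem_polyhedralCone q (H i)) g,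
      h_piece (t := {x | g q ≤ g x}) (convex_halfSpace_ge h_lin _)
        (isClosed_le continuous_const g.continuous) (le_refl (g q)) (Or.inl fun _ => id),
      h_piece (t := {x | g x ≤ g q}) (convex_halfSpace_le h_lin _)
        (isClosed_le g.continuous continuous_const) (le_refl (g q)) (Or.inr fun _ => id),
      h_piece (t := {x | g x = g q}) (convex_hyperplane h_lin _)
        (isClosed_eq g.continuous continuous_const) rfl (Or.inr fun _ => le_of_eq),
      add_zero, sub_zero]

end IsSetValuation

end InclusionExclusion

/-- For `0 < α i`, the points whose `i`-th coordinate is the first to vanish along the ray in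
direction `-α`. -/
def minRatioCone {ι : Type*} (α : ι → ℝ) (i : ι) : Set (ι → ℝ) :=
  {x | ∀ j, 0 < α j → x i / α i ≤ x j / α j}

theorem convex_minRatioCone {ι : Type*} (α : ι → ℝ) (i : ι) : Convex ℝ (minRatioCone α i) := by
  intro x hx y hy a b ha hb _ j hj
  simp only [Pi.add_apply, Pi.smul_apply, smul_eq_mul, add_div, mul_div_assoc]
  exact add_le_add (mul_le_mul_of_nonneg_left (hx j hj) ha)
    (mul_le_mul_of_nonneg_left (hy j hj) hb)

section Simplices

open scoped Pointwise

variable {V ι : Type*} [AddCommGroup V] [Module ℝ V] [Fintype ι]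

theorem isConvexBody_stdSimplex [Nonempty ι] : IsConvexBody (stdSimplex ℝ ι) := by
  classical
  exact ⟨convex_stdSimplex ℝ ι, isCompact_stdSimplex ℝ ι,
    _, single_mem_stdSimplex ℝ (Classical.arbitrary ι)⟩

theorem mem_smul_stdSimplex [Nonempty ι] {c : ℝ} (hc : 0 ≤ c) {x : ι → ℝ} :
    x ∈ c • stdSimplex ℝ ι ↔ (∀ i, 0 ≤ x i) ∧ ∑ i, x i = c := by
  classical
  refine ⟨?_, fun ⟨hx, hx_sum⟩ => ?_⟩
  · rintro ⟨y, hy, rfl⟩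
    exact ⟨fun i => mul_nonneg hc (hy.1 i),
      by simp only [Pi.smul_apply, smul_eq_mul, ← Finset.mul_sum, hy.2, mul_one]⟩
  · obtain rfl | hc_ne := eq_or_ne c 0
    · have hx_zero : x = 0 := funext fun i =>
        (Finset.sum_eq_zero_iff_of_nonneg fun i _ => hx i).1 hx_sum i (Finset.mem_univ i)
      rw [hx_zero]
      exact ⟨_, single_mem_stdSimplex ℝ (Classical.arbitrary ι), zero_smul ℝ _⟩
    · refine (Set.mem_smul_set_iff_inv_smul_mem₀ hc_ne _ _).2 ⟨fun i => ?_, ?_⟩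
      · exact mul_nonneg (inv_nonneg.2 hc) (hx i)
      · simp only [Pi.smul_apply, smul_eq_mul, ← Finset.mul_sum, hx_sum, inv_mul_cancel₀ hc_ne]

theorem smul_stdSimplex_inter_Ici [Nonempty ι] [DecidableEq ι] {a : ι → ℝ} (ha : ∀ i, 0 ≤ a i)
    (S : Finset ι) :
    (∑ i, a i) • stdSimplex ℝ ι ∩ ⋂ i ∈ S, {x | a i ≤ x i} =
      (S : Set ι).indicator a +ᵥ (∑ i ∈ Finset.univ \ S, a i) • stdSimplex ℝ ι := by
  ext x
  have h_split := Finset.sum_sdiff (f := a) (Finset.subset_univ S)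
  have h_sum : ∑ i, (S : Set ι).indicator a i = ∑ i ∈ S, a i :=
    Finset.sum_indicator_subset a (Finset.subset_univ S)
  simp only [Set.mem_vadd_set_iff_neg_vadd_mem, Set.mem_inter_iff, Set.mem_iInter₂,
    Set.mem_ofPred_eq, mem_smul_stdSimplex (Finset.sum_nonneg fun i _ => ha i), vadd_eq_add,
    neg_add_eq_sub, Pi.sub_apply, Finset.sum_sub_distrib, h_sum, sub_nonneg]
  refine ⟨fun ⟨⟨hx, _⟩, hxS⟩ => ⟨fun i => ?_, by linarith⟩,
    fun ⟨hx, _⟩ => ⟨⟨fun i => ?_, by linarith⟩, fun i hi => ?_⟩⟩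
  · exact Set.indicator_le' (fun i hi => hxS i hi) (fun i _ => hx i) i
  · exact (Set.indicator_nonneg (fun i _ => ha i) i).trans (hx i)
  · simpa only [Set.indicator_of_mem (Finset.mem_coe.2 hi)] using hx i

theorem linearCombination_image_stdSimplex (v : ι → V) :
    Fintype.linearCombination ℝ v '' stdSimplex ℝ ι = convexHull ℝ (Set.range v) := by
  classical
  rw [← convexHull_basis_eq_stdSimplex, LinearMap.image_convexHull, ← Set.range_comp]
  congr 2
  funext i
  simp [Fintype.linearCombination_apply]

theorem linearCombination_mem_convexHull_image {v : ι → V} {x : ι → ℝ} (hx : x ∈ stdSimplex ℝ ι)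
    {S : Finset ι} (hxS : ∀ i ∈ S, x i = 0) :
    Fintype.linearCombination ℝ v x ∈ convexHull ℝ (v '' (S : Set ι)ᶜ) := by
  classical
  have h_compl (i : ι) (hi : i ∉ Sᶜ) : x i = 0 := hxS i (by simpa using hi)
  rw [Fintype.linearCombination_apply, ← Finset.sum_subset (Finset.subset_univ Sᶜ)
    fun i _ hi => by rw [h_compl i hi, zero_smul]]
  refine (convex_convexHull ℝ _).sum_mem (fun i _ => hx.1 i) ?_ fun i hi =>
    subset_convexHull ℝ _ (Set.mem_image_of_mem v (by simpa using hi))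
  rw [← hx.2]
  exact Finset.sum_subset (Finset.subset_univ _) fun i _ hi => h_compl i hi

theorem sub_smul_mem_stdSimplex {α : ι → ℝ} (h_sum : ∑ i, α i = 0) {x : ι → ℝ}
    (hx : x ∈ stdSimplex ℝ ι) {i : ι} (hi : 0 < α i) (hxi : x ∈ minRatioCone α i) :
    x - (x i / α i) • α ∈ stdSimplex ℝ ι := by
  refine ⟨fun j => ?_, ?_⟩
  · simp only [Pi.sub_apply, Pi.smul_apply, smul_eq_mul, sub_nonneg]
    obtain hj | hj := le_or_gt (α j) 0
    · exact (mul_nonpos_of_nonneg_of_nonpos (div_nonneg (hx.1 i) hi.le) hj).trans (hx.1 j)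
    · exact (le_div_iff₀ hj).1 (hxi j hj)
  · simp only [Pi.sub_apply, Pi.smul_apply, smul_eq_mul, Finset.sum_sub_distrib, ← Finset.mul_sum,
      h_sum, mul_zero, sub_zero, hx.2]

theorem linearCombination_image_inter_minRatioCone {v : ι → V} {α : ι → ℝ} (h_sum : ∑ i, α i = 0)
    (h_rel : Fintype.linearCombination ℝ v α = 0) {S : Finset ι} (hS : ∀ i ∈ S, 0 < α i) :
    Fintype.linearCombination ℝ v '' (stdSimplex ℝ ι ∩ ⋂ i ∈ S, minRatioCone α i) =
      convexHull ℝ (v '' (S : Set ι)ᶜ) := by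
  classical
  refine Set.Subset.antisymm ?_ (convexHull_min ?_ ?_)
  · rintro _ ⟨x, ⟨hx, hxS⟩, rfl⟩
    rw [Set.mem_iInter₂] at hxS
    obtain rfl | ⟨i, hi⟩ := S.eq_empty_or_nonempty
    · exact linearCombination_mem_convexHull_image hx fun i hi => absurd hi (Finset.notMem_empty i)
    · have h_image : Fintype.linearCombination ℝ v (x - (x i / α i) • α) =
          Fintype.linearCombination ℝ v x := by
        rw [map_sub, map_smul, h_rel, smul_zero, sub_zero]
      rw [← h_image]
      refine linearCombination_mem_convexHull_image
        (sub_smul_mem_stdSimplex h_sum hx (hS i hi) (hxS i hi)) fun j hj => ?_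
      have h_ratio : x i / α i = x j / α j :=
        (hxS i hi j (hS j hj)).antisymm (hxS j hj i (hS i hi))
      rw [Pi.sub_apply, Pi.smul_apply, smul_eq_mul, h_ratio, div_mul_cancel₀ _ (hS j hj).ne',
        sub_self]
  · rintro _ ⟨i, hi, rfl⟩
    refine ⟨Pi.single i 1, ⟨single_mem_stdSimplex ℝ i, Set.mem_iInter₂.2 fun j hj k hk => ?_⟩, ?_⟩
    · have h_ne : j ≠ i := fun h => hi (h ▸ hj)
      rw [Pi.single_eq_of_ne h_ne, zero_div]
      exact div_nonneg ((single_mem_stdSimplex ℝ i).1 k) hk.le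
    · rw [Fintype.linearCombination_apply_single, one_smul]
  · exact ((convex_stdSimplex ℝ ι).inter
      (convex_iInter₂ fun i _ => convex_minRatioCone α i)).linear_image _

end Simplices

section DilatesOfPolytopes

open scoped Pointwise

theorem linear_image_vadd_smul {𝓕 E F : Type*} [AddCommGroup E] [Module ℝ E] [AddCommGroup F]
    [Module ℝ F] [FunLike 𝓕 E F] [LinearMapClass 𝓕 ℝ E F] (L : 𝓕) (w : E) (c : ℝ) (s : Set E) :
    L '' (w +ᵥ c • s) = L w +ᵥ c • L '' s := by
  simp only [← Set.image_smul, ← Set.image_vadd, Set.image_image, vadd_eq_add, map_add, map_smul]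

/-- Invariance of a function on convex bodies under all translations. -/
def IsTranslationInvariant {V A : Type*} [NormedAddCommGroup V] [NormedSpace ℝ V]
    (φ : ConvexBody V → A) : Prop :=
  ∀ (v : V) (K K' : ConvexBody V), (K' : Set V) = v +ᵥ (K : Set V) → φ K' = φ K

theorem exists_map_univ_val_eq {ι S : Type*} [Fintype ι] (s : Multiset S)
    (hs : s.card = Fintype.card ι) : ∃ a : ι → S, Finset.univ.val.map a = s := by
  classical
  let e : ι ≃ s := Fintype.equivOfCardEq (hs.symm.trans (Multiset.card_coe s).symm)
  refine ⟨fun i => (e i).1, ?_⟩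
  conv_rhs => rw [← Multiset.map_univ_coe s, ← Finset.map_univ_equiv e, Finset.map_val,
    Multiset.map_map]
  rfl

variable {V A ι : Type*} [NormedAddCommGroup V] [NormedSpace ℝ V] [AddCommGroup A]
  {φ : ConvexBody V → A}

theorem IsTranslationInvariant.setExtension_vadd (h : IsTranslationInvariant φ) (v : V)
    (K : ConvexBody V) : setExtension φ (v +ᵥ (K : Set V)) = φ K := by
  let K' : ConvexBody V :=
    ⟨v +ᵥ (K : Set V), K.convex.vadd v, K.isCompact.vadd v, K.nonempty.vadd_set⟩
  rw [← h v K K' rfl, ← setExtension_coe φ K']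
  rfl

variable [Fintype ι]

theorem smul_stdSimplex_subset_iUnion_polyhedralCone [Nonempty ι] {a : ι → ℝ}
    (ha : ∀ i, 0 ≤ a i) : (∑ i, a i) • stdSimplex ℝ ι ⊆
      ⋃ i ∈ Finset.univ, polyhedralCone a {ContinuousLinearMap.proj (R := ℝ) i} := by
  intro x hx
  have hx_sum := ((mem_smul_stdSimplex (Finset.sum_nonneg fun i _ => ha i)).1 hx).2
  obtain ⟨i, hi, h_le⟩ := Finset.exists_le_of_sum_le Finset.univ_nonempty hx_sum.ge
  refine Set.mem_iUnion₂.2 ⟨i, hi, ?_⟩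
  rintro _ rfl
  exact h_le

/-- The cones `{x | a i ≤ x i}` cover the dilated simplex `{x | 0 ≤ x, ∑ x = ∑ a}`, and they
intersect it in translates of smaller dilates of the same simplex. -/
theorem IsValuation.mixedDiff_smul_convexHull_range_eq_zero [Nonempty ι] (hφ : IsValuation φ)
    (h_trans : IsTranslationInvariant φ) {v : ι → V} {P : ConvexBody V}
    (hP : (P : Set V) = convexHull ℝ (Set.range v)) (a : ι → ℝ≥0) :
    mixedDiff (Finset.univ.val.map a) (fun r => φ (r • P)) 0 = 0 := by
  classical
  let L : (ι → ℝ) →L[ℝ] V := (Fintype.linearCombination ℝ v).toContinuousLinearMap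
  let b (i : ι) : ℝ := a i
  have hb (i : ι) : 0 ≤ b i := (a i).2
  have h_sum : 0 ≤ ∑ i, b i := Finset.sum_nonneg fun i _ => hb i
  have h_dilate (r : ℝ≥0) : (r • P : Set V) = (r : ℝ) • L '' stdSimplex ℝ ι := by
    rw [hP, ← linearCombination_image_stdSimplex]
    rfl
  have h_cone (i : ι) :
      polyhedralCone b {ContinuousLinearMap.proj (R := ℝ) i} = {x | b i ≤ x i} := by
    simp only [polyhedralCone, Set.mem_singleton_iff, forall_eq, ContinuousLinearMap.proj_apply]
  have h_term (S : Finset ι) : setExtension φ (L '' ((∑ i, b i) • stdSimplex ℝ ι ∩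
      ⋂ i ∈ S, polyhedralCone b {ContinuousLinearMap.proj (R := ℝ) i})) =
        φ ((∑ i ∈ Finset.univ \ S, a i) • P) := by
    simp only [h_cone]
    rw [smul_stdSimplex_inter_Ici hb, linear_image_vadd_smul, ← NNReal.coe_sum, ← h_dilate,
      ← ConvexBody.coe_smul', h_trans.setExtension_vadd]
  have h_defect := (hφ.isSetValuation.comp_image L).coverDefect_polyhedralCone_eq_zero
    (isConvexBody_stdSimplex.smul _)
    ((mem_smul_stdSimplex h_sum).2 ⟨hb, rfl⟩) (fun i _ => Set.finite_singleton _)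
    (smul_stdSimplex_subset_iUnion_polyhedralCone hb)
  simpa only [coverDefect, h_term, mixedDiff_map_val, zero_add] using h_defect

theorem IsValuation.isFrechetPolynomial_smul_polytope (hφ : IsValuation φ)
    (h_trans : IsTranslationInvariant φ) {t : Finset V} (ht : t.Nonempty) {n : ℕ}
    (hn : t.card ≤ n + 1) : IsFrechetPolynomial n fun r : ℝ≥0 => φ (r • polytope t ht) := by
  have := ht.to_subtype
  have h_card : t.card = t.card - 1 + 1 := (Nat.sub_add_cancel ht.card_pos).symm
  refine IsFrechetPolynomial.mono (m := t.card - 1) (fun s hs => ?_) (by omega)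
  obtain ⟨a, rfl⟩ := exists_map_univ_val_eq (ι := t) s
    (hs.trans (h_card.symm.trans (Fintype.card_coe t).symm))
  refine hφ.mixedDiff_smul_convexHull_range_eq_zero h_trans (v := ((↑) : t → V)) ?_ a
  rw [Subtype.range_coe]
  rfl

end DilatesOfPolytopes

section AffineDependence

variable {ι : Type*} {α : ι → ℝ}

theorem exists_mem_minRatioCone [Finite ι] (hα : ∃ i, 0 < α i) (x : ι → ℝ) :
    ∃ i, 0 < α i ∧ x ∈ minRatioCone α i :=
  Set.exists_min_image {i | 0 < α i} (fun i => x i / α i) (Set.toFinite _) hα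

variable [Fintype ι]

theorem exists_polyhedralCone_eq_minRatioCone [DecidableEq ι] {m : ι} (hm : α m < 0) (i : ι)
    (hi : 0 < α i) : ∃ H : Set ((ι → ℝ) →L[ℝ] ℝ), H.Finite ∧
      polyhedralCone (Pi.single m 1) H = minRatioCone α i := by
  let u (j : ι) : (ι → ℝ) →L[ℝ] ℝ := (α j)⁻¹ • ContinuousLinearMap.proj j
  have hu (j : ι) (x : ι → ℝ) : u j x = x j / α j := inv_mul_eq_div (α j) (x j)
  have hu_apex (j : ι) (hj : 0 < α j) : u j (Pi.single m 1) = 0 := by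
    have h_ne : j ≠ m := fun h => (h ▸ hj).not_gt hm
    rw [hu, Pi.single_eq_of_ne h_ne, zero_div]
  refine ⟨(fun j => u j - u i) '' {j | 0 < α j}, Set.toFinite _, Set.ext fun x => ?_⟩
  refine Set.forall_mem_image.trans (forall₂_congr fun j hj => ?_)
  rw [sub_apply, sub_apply, hu_apex i hi, hu_apex j hj, sub_zero, sub_nonneg, hu, hu]

variable {V A : Type*} [NormedAddCommGroup V] [NormedSpace ℝ V] [AddCommGroup A]
  {φ : ConvexBody V → A}

/-- For an affine dependence `α` of the points `v i`, the simplex is covered by the cones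
`minRatioCone α i` with `0 < α i`, and subtracting multiples of `α` shows that intersections of
these cones map onto hulls of proper subfamilies. -/
theorem IsValuation.setExtension_convexHull_range_eq_zero (hφ : IsValuation φ) {v : ι → V}
    (h_sum : ∑ i, α i = 0) (h_rel : Fintype.linearCombination ℝ v α = 0) (h_ne : α ≠ 0)
    (h_faces : ∀ S : Finset ι, S.Nonempty → (S : Set ι)ᶜ.Nonempty →
      setExtension φ (convexHull ℝ (v '' (S : Set ι)ᶜ)) = 0) :
    setExtension φ (convexHull ℝ (Set.range v)) = 0 := by
  classical
  obtain ⟨i, hi⟩ := Function.ne_iff.1 h_ne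
  obtain ⟨p, -, hp⟩ := Finset.exists_pos_of_sum_zero_of_exists_nonzero α h_sum
    ⟨i, Finset.mem_univ i, hi⟩
  obtain ⟨m, -, hm⟩ : ∃ m ∈ Finset.univ, 0 < -α m :=
    Finset.exists_pos_of_sum_zero_of_exists_nonzero (fun i => -α i)
      (by rw [Finset.sum_neg_distrib, h_sum, neg_zero]) ⟨i, Finset.mem_univ i, neg_ne_zero.2 hi⟩
  have : Nonempty ι := ⟨p⟩
  choose! H hH_fin hH using exists_polyhedralCone_eq_minRatioCone (neg_pos.1 hm)
  let L : (ι → ℝ) →L[ℝ] V := (Fintype.linearCombination ℝ v).toContinuousLinearMap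
  let W : Finset ι := {i | 0 < α i}
  have hW {i : ι} : i ∈ W ↔ 0 < α i := Finset.mem_filter_univ i
  have h_cover : stdSimplex ℝ ι ⊆ ⋃ i ∈ W, polyhedralCone (Pi.single m 1) (H i) := by
    intro x _
    obtain ⟨i, hi, hx⟩ := exists_mem_minRatioCone ⟨p, hp⟩ x
    exact Set.mem_iUnion₂.2 ⟨i, hW.2 hi, (hH i hi).symm ▸ hx⟩
  have h_piece (S : Finset ι) (hS : S ⊆ W) :
      L '' (stdSimplex ℝ ι ∩ ⋂ i ∈ S, polyhedralCone (Pi.single m 1) (H i)) =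
        convexHull ℝ (v '' (S : Set ι)ᶜ) := by
    rw [Set.iInter₂_congr fun i hi => hH i (hW.1 (hS hi))]
    exact linearCombination_image_inter_minRatioCone h_sum h_rel fun i hi => hW.1 (hS hi)
  have h_defect := (hφ.isSetValuation.comp_image L).coverDefect_polyhedralCone_eq_zero
    isConvexBody_stdSimplex (single_mem_stdSimplex ℝ m) (fun i hi => hH_fin i (hW.1 hi)) h_cover
  rw [coverDefect, Finset.sum_eq_single_of_mem ∅ (Finset.empty_mem_powerset W)] at h_defect
  · simpa only [h_piece ∅ (Finset.empty_subset W), Finset.card_empty, pow_zero, one_smul,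
      Finset.coe_empty, Set.compl_empty, Set.image_univ] using h_defect
  · intro S hS hS_ne
    have hSW := Finset.mem_powerset.1 hS
    have hmS : m ∉ S := fun hmS => (hW.1 (hSW hmS)).not_gt (neg_pos.1 hm)
    rw [h_piece S hSW, h_faces S (Finset.nonempty_iff_ne_empty.2 hS_ne) ⟨m, hmS⟩, smul_zero]

theorem IsValuation.eq_zero_of_forall_card_le [FiniteDimensional ℝ V] (hφ : IsValuation φ)
    (h_simplex : ∀ t ht, t.card ≤ Module.finrank ℝ V + 1 → φ (polytope t ht) = 0)
    (t : Finset V) (ht : t.Nonempty) : φ (polytope t ht) = 0 := by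
  induction h_card : t.card using Nat.strong_induction_on generalizing t with
  | h n ih =>
    obtain h_le | h_lt := le_or_gt t.card (Module.finrank ℝ V + 1)
    · exact h_simplex t ht h_le
    · obtain ⟨f, hf_rel, hf_sum, x, hx, hfx⟩ :=
        Module.exists_nontrivial_relation_sum_zero_of_finrank_succ_lt_card (R := ℝ) h_lt
      have h_range : convexHull ℝ (Set.range ((↑) : t → V)) = polytope t ht := by
        rw [Subtype.range_coe]
        rfl
      rw [← setExtension_coe φ, ← h_range]
      refine hφ.setExtension_convexHull_range_eq_zero (α := fun i : t => f i)
        ((Finset.sum_coe_sort t f).trans hf_sum) ?_ (fun h => hfx (congrFun h ⟨x, hx⟩)) ?_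
      · rw [Fintype.linearCombination_apply, ← hf_rel]
        exact Finset.sum_coe_sort t fun x => f x • x
      · intro S hS hS_compl
        classical
        have h_face : ((↑) : t → V) '' (S : Set t)ᶜ = Sᶜ.map (Function.Embedding.subtype _) := by
          rw [Finset.coe_map, Finset.coe_compl]
          rfl
        have h_ne : (Sᶜ.map (Function.Embedding.subtype (· ∈ t))).Nonempty := by
          rwa [← Finset.coe_nonempty, ← h_face, Set.image_nonempty]
        rw [h_face]
        refine (setExtension_coe φ (polytope _ h_ne)).trans (ih _ ?_ _ h_ne rfl)
        rw [← h_card, Finset.card_map, ← Fintype.card_coe t]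
        exact Finset.card_compl_lt_iff_nonempty S |>.2 hS

theorem IsValuation.isFrechetPolynomial_smul [FiniteDimensional ℝ V] [TopologicalSpace A]
    [IsTopologicalAddGroup A] [T2Space A] (hφ : IsValuation φ) (h_cont : Continuous φ)
    (h_trans : IsTranslationInvariant φ) (K : ConvexBody V) :
    IsFrechetPolynomial (Module.finrank ℝ V) fun r : ℝ≥0 => φ (r • K) := by
  intro s hs
  have h_val := hφ.mixedDiff_smul s 0
  have h_diff_cont : Continuous fun K => mixedDiff s (fun r => φ (r • K)) 0 :=
    (continuous_mixedDiff (f := fun (r : ℝ≥0) (K : ConvexBody V) => φ (r • K))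
      (h_cont.comp continuous_smul) s).comp (continuous_const.prodMk continuous_id)
  have h_zero := h_val.eq_zero_of_forall_card_le fun t ht h_card =>
    hφ.isFrechetPolynomial_smul_polytope h_trans ht h_card s hs
  refine congrFun (h_diff_cont.ext_on dense_polytopes (continuous_const (y := 0)) ?_) K
  rintro _ ⟨t, ht, rfl⟩
  exact h_zero t ht

end AffineDependence

section Dilations

variable {V : Type*} [NormedAddCommGroup V] [NormedSpace ℝ V] [FiniteDimensional ℝ V]
  {G : Subgroup (V ≃ᵃ[ℝ] V)}

theorem isTranslationInvariant_universalValuation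
    (hG : ∀ v : V, AffineEquiv.constVAdd ℝ V v ∈ G) :
    IsTranslationInvariant (universalValuation G) := by
  intro v K K' h
  rw [← isAffineInvariant_universalValuation G _ (hG v) K]
  exact congrArg _ (ConvexBody.ext h)

theorem universalValuation_smul_affineImage (hG : ∀ v : V, AffineEquiv.constVAdd ℝ V v ∈ G)
    {g : V ≃ᵃ[ℝ] V} (hg : g ∈ G) (r : ℝ≥0) (K : ConvexBody V) :
    universalValuation G (r • affineImage g K) = universalValuation G (r • K) := by
  have h_affine (x : V) : g x = g.linear x + g 0 := by
    simpa only [vadd_eq_add, add_zero] using g.map_vadd 0 x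
  have h_translate (x : V) : (r • g 0 - g 0) + g (r • x) = r • g x := by
    rw [h_affine (r • x), h_affine x, NNReal.smul_def, NNReal.smul_def, NNReal.smul_def, map_smul,
      smul_add]
    abel
  rw [← isAffineInvariant_universalValuation G g hg (r • K)]
  refine isTranslationInvariant_universalValuation hG (r • g 0 - g 0) _ _ ?_
  change (r • ·) '' (g '' (K : Set V)) =
    (fun x => (r • g 0 - g 0) + x) '' (g '' ((r • ·) '' (K : Set V)))
  simp only [Set.image_image, h_translate]

theorem exists_isDilationMap (hG : ∀ v : V, AffineEquiv.constVAdd ℝ V v ∈ G) :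
    ∃ D : ℝ≥0 → CB V G →+ CB V G, IsDilationMap G D := by
  let orbit : C(ConvexBody V, C(ℝ≥0, CB V G)) := ContinuousMap.curry
    ⟨fun p => universalValuation G (p.2 • p.1),
      (continuous_universalValuation G).comp (continuous_snd.smul continuous_fst)⟩
  have h_val : IsValuation orbit := fun B C U I hU hI =>
    ContinuousMap.ext fun r => (isValuation_universalValuation G).smul r B C U I hU hI
  have h_inv : IsAffineInvariant G orbit := fun g hg K =>
    ContinuousMap.ext fun r => universalValuation_smul_affineImage hG hg r K
  obtain ⟨f, hf, hf_univ⟩ := CB.exists_lift (map_continuous orbit) h_val h_inv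
  refine ⟨fun r => AddMonoidHom.mk' (fun x => f x r) fun x y =>
    DFunLike.congr_fun (map_add f x y) r, ?_, fun r X => ?_⟩
  · exact (hf.comp continuous_snd).eval continuous_fst
  · exact DFunLike.congr_fun (hf_univ X) r

namespace IsDilationMap

variable {D D' : ℝ≥0 → CB V G →+ CB V G}

theorem unique (hD : IsDilationMap G D) (hD' : IsDilationMap G D') : D' = D :=
  funext fun r => CB.hom_ext fun X => by rw [hD.2, hD'.2]

theorem isFrechetPolynomial (hG : ∀ v : V, AffineEquiv.constVAdd ℝ V v ∈ G)
    (hD : IsDilationMap G D) (x : CB V G) :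
    IsFrechetPolynomial (Module.finrank ℝ V) fun r => D r x := by
  intro s hs
  let diffHom : CB V G →+ CB V G := AddMonoidHom.ofMapSub (fun x => mixedDiff s (D · x) 0)
    fun x y => by
      simp only [map_sub]
      exact congrFun (mixedDiff_sub s (D · x) (D · y)) 0
  refine DFunLike.congr_fun (CB.hom_ext (f := diffHom) (g := 0) fun X => ?_) x
  change mixedDiff s (fun r => D r (universalValuation G X)) 0 = 0
  simp only [hD.2]
  exact (isValuation_universalValuation G).isFrechetPolynomial_smul
    (continuous_universalValuation G) (isTranslationInvariant_universalValuation hG) X s hs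

variable {d : ℕ} {ρ : Fin (d + 1) → ℝ≥0 → CB V G → CB V G}

theorem isPolynomialAction (hD : IsDilationMap G D)
    (hρ : ∀ x, IsPolynomialExpansion (fun r => D r x) fun i r => ρ i r x) :
    IsPolynomialAction D ρ where
  one_apply := DFunLike.congr_fun <| CB.hom_ext (f := D 1) (g := AddMonoidHom.id _) fun X => by
    rw [hD.2, one_smul, AddMonoidHom.id_apply]
  mul_apply r s := DFunLike.congr_fun <| CB.hom_ext (g := (D r).comp (D s)) fun X => by
    rw [AddMonoidHom.comp_apply, hD.2, hD.2, hD.2, mul_smul]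
  expansion := hρ

theorem projection_zero_universalValuation (hD : IsDilationMap G D) (h : IsPolynomialAction D ρ)
    (X : ConvexBody V) : h.projection 0 (universalValuation G X) = universalValuation G 0 := by
  rw [← zero_smul ℝ≥0 X, ← hD.2]
  exact ((h.expansion _).apply_zero 1).symm

theorem exists_module_range (hD : IsDilationMap G D) (h : IsPolynomialAction D ρ)
    {i : Fin (d + 1)} (hi : i ≠ 0) (h_cont : Continuous fun p : ℝ≥0 × CB V G => ρ i p.1 p.2) :
    ∃ _ : Module ℝ (h.projection i).range, ContinuousSMul ℝ (h.projection i).range ∧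
      ∀ r : ℝ, 0 ≤ r → ∀ X : ConvexBody V,
        (h.projection i).rangeRestrict (universalValuation G (r • X)) =
          r ^ (i : ℕ) • (h.projection i).rangeRestrict (universalValuation G X) := by
  obtain ⟨inst, h_smul_cont, h_smul⟩ := h.exists_module_range hi h_cont
  refine ⟨inst, h_smul_cont, fun r hr X => ?_⟩
  lift r to ℝ≥0 using hr
  rw [← h_smul, hD.2]
  rfl

end IsDilationMap

theorem exists_continuous_eulerCharacteristic :
    ∃ χ : CB V G →+ ℤ, Continuous χ ∧ ∀ X, χ (universalValuation G X) = 1 :=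
  CB.exists_lift continuous_const (fun _ _ _ _ _ _ => rfl) fun _ _ _ => rfl

theorem CB.exists_int_continuousAddEquiv {e : CB V G →+ CB V G}
    (he : ∀ X, e (universalValuation G X) = universalValuation G 0) :
    ∃ β : ℤ ≃ₜ+ e.range, (β 1 : CB V G) = universalValuation G 0 := by
  obtain ⟨χ, hχ, hχ_univ⟩ := exists_continuous_eulerCharacteristic (G := G)
  have he_eq : e = (zmultiplesHom _ (universalValuation G 0)).comp χ := CB.hom_ext fun X => by
    rw [he, AddMonoidHom.comp_apply, hχ_univ, zmultiplesHom_apply, one_zsmul]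
  exact exists_int_continuousAddEquiv_range hχ (hχ_univ 0) (DFunLike.congr_fun he_eq)

theorem universalValuation_eq_of_coe_eq_singleton (hG : ∀ v : V, AffineEquiv.constVAdd ℝ V v ∈ G)
    {X : ConvexBody V} {v : V} (hX : (X : Set V) = {v}) :
    universalValuation G X = universalValuation G 0 := by
  refine isTranslationInvariant_universalValuation hG v 0 X ?_
  rw [hX, ConvexBody.coe_zero, ← Set.singleton_zero, Set.vadd_set_singleton, vadd_eq_add, add_zero]

end Dilations

end

theorem theoremB {V : Type*} [NormedAddCommGroup V] [NormedSpace ℝ V] [FiniteDimensional ℝ V]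
    (d : ℕ) (hd : Module.finrank ℝ V = d)
    (G : Subgroup (V ≃ᵃ[ℝ] V)) (hG : ∀ v : V, AffineEquiv.constVAdd ℝ V v ∈ G) :
    -- the dilation map `D` exists and is unique
    ∃ D : ℝ≥0 → CB V G →+ CB V G,
      IsDilationMap G D ∧ (∀ D', IsDilationMap G D' → D' = D) ∧
    -- it has unique dilation components `ρ₀, …, ρ_d`, which are continuous
    ∃ ρ : Fin (d + 1) → ℝ≥0 → CB V G → CB V G,
      (∀ x, IsPolynomialExpansion (fun r => D r x) (fun i r => ρ i r x)) ∧
      (∀ ρ' : Fin (d + 1) → ℝ≥0 → CB V G → CB V G,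
        (∀ x, IsPolynomialExpansion (fun r => D r x) (fun i r => ρ' i r x)) → ρ' = ρ) ∧
      (∀ i, Continuous (fun p : ℝ≥0 × CB V G => ρ i p.1 p.2)) ∧
    -- the McMullen idempotents `e_i = ρ_i(1, -)`: continuous endomorphisms which form a
    -- complete set of orthogonal idempotents
    ∃ e : Fin (d + 1) → CB V G →+ CB V G,
      (∀ i x, e i x = ρ i 1 x) ∧
      (∀ i, Continuous (e i)) ∧
      (∀ x, ∑ i, e i x = x) ∧
      (∀ i x, e i (e i x) = e i x) ∧
      (∀ i j, i ≠ j → ∀ x, e i (e j x) = 0) ∧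
    -- the summands `CB_i = e_i(CB)` are closed and Hausdorff
      T2Space (CB V G) ∧
      (∀ i, IsClosed ((e i).range : Set (CB V G)) ∧ T2Space (e i).range) ∧
    -- the group of convex bodies is their direct sum as a topological group, via the projections
    -- `e_i`, and `Φ = Φ₀ ⊕ ⋯ ⊕ Φ_d` for continuous `G`-invariant valuations `Φ_i`
    ∃ T : CB V G ≃ₜ+ ((i : Fin (d + 1)) → (e i).range),
      (∀ x i, ((T x i : (e i).range) : CB V G) = e i x) ∧
    ∃ Φ : (i : Fin (d + 1)) → ConvexBody V → (e i).range,
      (∀ X i, T (universalValuation G X) i = Φ i X) ∧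
      (∀ i, Continuous (Φ i) ∧ IsAffineInvariant G (Φ i) ∧ IsValuation (Φ i)) ∧
    -- `CB₀` is a copy of `ℤ`, generated by `Φ₀(X)` for any `X`, and by the class of any
    -- one-point convex body
      (∃ β : ℤ ≃ₜ+ (e 0).range,
        (∀ X, β 1 = Φ 0 X) ∧
        (∀ (X : ConvexBody V) (v : V), (X : Set V) = {v} →
          ((β 1 : (e 0).range) : CB V G) = universalValuation G X)) ∧
    -- for `i ≥ 1`, `CB_i` is a real topological vector space, extending its structure of
    -- topological abelian group, and `Φ_i` is homogeneous of degree `i`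
      (∀ i : Fin (d + 1), i ≠ 0 →
        ∃ _ : Module ℝ (e i).range,
          ContinuousSMul ℝ (e i).range ∧
          ∀ (r : ℝ), 0 ≤ r → ∀ X : ConvexBody V, Φ i (r • X) = r ^ (i : ℕ) • Φ i X) := by
  subst hd
  obtain ⟨D, hD⟩ := exists_isDilationMap hG
  obtain ⟨ρ, hρ, hρ_cont⟩ := exists_isPolynomialExpansion hD.1 (hD.isFrechetPolynomial hG)
  have h := hD.isPolynomialAction hρ
  have he_cont (i) : Continuous (h.projection i) :=
    (hρ_cont i).comp (continuous_const.prodMk continuous_id)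
  have he_idem (i x) : h.projection i (h.projection i x) = h.projection i x :=
    (h.projection_projection i i x).trans (if_pos rfl)
  have he_zero := hD.projection_zero_universalValuation h
  obtain ⟨β, hβ⟩ := CB.exists_int_continuousAddEquiv he_zero
  exact ⟨D, hD, fun _ => hD.unique,
    ρ, hρ, fun ρ' hρ' => funext fun i => funext₂ fun r x => congrFun₂ ((hρ' x).unique (hρ x)) i r,
    hρ_cont, h.projection, fun _ _ => rfl, he_cont, h.sum_projection, he_idem,
    fun i j hij x => (h.projection_projection i j x).trans (if_neg hij), inferInstance,
    fun i => ⟨isClosed_range_of_idempotent (he_cont i) (he_idem i), inferInstance⟩,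
    continuousAddEquivPiRange _ he_cont h.projection_projection h.sum_projection, fun _ _ => rfl,
    fun i X => (h.projection i).rangeRestrict (universalValuation G X), fun _ _ => rfl,
    fun i => ⟨((he_cont i).comp (continuous_universalValuation G)).subtype_mk _,
      (isAffineInvariant_universalValuation G).map _, (isValuation_universalValuation G).map _⟩,
    ⟨β, fun X => Subtype.ext (hβ.trans (he_zero X).symm),
      fun X v hX => hβ.trans (universalValuation_eq_of_coe_eq_singleton hG hX).symm⟩,
    fun i hi => hD.exists_module_range h hi (hρ_cont i)⟩
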